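/- Let $k\ge 0$, $n_1,\dots,n_k\ge 0$ be integers and $q_1,\dots,q_k\in\mathbb C^\times$, and let $\mathcal H=\mathcal H(n_1,q_1)\otimes_{\mathbb C}\cdots\otimes_{\mathbb C}\mathcal H(n_k,q_k)$. Here $\mathcal H(n,q)$ is the affine Hecke algebra of type A: the $\mathbb C$-algebra generated by $T_1,\dots,T_{n-1}$ and $y_1^{\pm1},\dots,y_n^{\pm1}$, where the $y_j$ commute with each other, $T_iT_{i+1}T_i=T_{i+1}T_iT_{i+1}$, $T_iT_j=T_jT_i$ for $|i-j|>1$, $(T_i-q)(T_i+1)=0$, $T_iy_iT_i=q\,y_{i+1}$, and $T_iy_j=y_jT_i$ for $j\ne i,i+1$. (Every Bernstein block of $\mathrm{GL}_m(F)$, $F$ a non-archimedean local field, is equivalent to the category of modules over such an algebra $\mathcal H$, and its finitely generated representations are viewed as finitely generated $\mathcal H$-modules.) Let $\mathcal Z$ be the centre of $\mathcal H$, $\mathcal J\subset\mathcal Z$ a maximal ideal, and $\widehat{\mathcal Z}=\varprojlim_i \mathcal Z/\mathcal J^i$. For an $\mathcal H$-module $\tau$ put $\widehat\tau=\varprojlim_i\tau/\mathcal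 J^i\tau$; this is an $\mathcal H$-module on which $\widehat{\mathcal Z}$ acts by $\mathcal H$-endomorphisms. Let $\widehat{\mathcal C}(\mathcal J)$ be the full subcategory of the category of $\mathcal H$-modules whose objects are the modules isomorphic to $\widehat\tau$ for some $\mathcal H$-module $\tau$ such that $\tau/\mathcal J^i\tau$ has finite length for all $i$. Let $\pi_1,\pi_2$ be finitely generated $\mathcal H$-modules. Then $\widehat{\mathcal C}(\mathcal J)$ is an abelian category, $\widehat\pi_1$ and $\widehat\pi_2$ are objects of it, and for every $i\ge0$ there are isomorphisms of $\widehat{\mathcal Z}$-modules $$\mathrm{Ext}^i_{\mathcal H}(\pi_1,\widehat\pi_2)\;\cong\;\widehat{\mathcal Z}\otimes_{\mathcal Z}\mathrm{Ext}^i_{\mathcal H}(\pi_1,\pi_2)\;\cong\;\mathrm{Ext}^i_{\widehat{\mathcal C}(\mathcal J)}(\widehat\pi_1,\widehat\pi_2),$$ where $\widehat{\mathcal Z}$ acts on the outer terms through $\widehat\pi_2$ and $\mathcal Z$ acts on $\mathrm{Ext}^i_{\mathcal H}(\pi_1,\pi_2)$ through $\pi_2$. Suppose moreover that at least one of $\pi_1,\pi_2$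 has finite length and belongs to $\widehat{\mathcal C}(\mathcal J)$. If $\dim_{\mathbb C}\mathrm{Ext}^i_{\mathcal H}(\pi_1,\pi_2)<\infty$, then there is an isomorphism of $\mathcal Z$-modules $$\mathrm{Ext}^i_{\mathcal H}(\pi_1,\pi_2)\;\cong\;\mathrm{Ext}^i_{\widehat{\mathcal C}(\mathcal J)}(\widehat\pi_1,\widehat\pi_2).$$ -/

import Mathlib

open CategoryTheory CategoryTheory.Abelian
open scoped TensorProduct

/-! ### Affine Hecke algebras of type A -/

/-- Generators of the affine Hecke algebra `𝓗(n, q)`: `T i` for `0 ≤ i < n - 1`, and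
`y j`, `yInv j` for `0 ≤ j < n` (indices start at `0`). -/
inductive AffineHeckeGen (n : ℕ) : Type
  | T (i : ℕ) (hi : i + 1 < n) : AffineHeckeGen n
  | y (j : Fin n) : AffineHeckeGen n
  | yInv (j : Fin n) : AffineHeckeGen n

namespace AffineHeckeGen

/-- The generator `T i` in the free algebra. -/
noncomputable abbrev fT {n : ℕ} (i : ℕ) (hi : i + 1 < n) : FreeAlgebra ℂ (AffineHeckeGen n) :=
  FreeAlgebra.ι ℂ (T i hi)

/-- The generator `y j` in the free algebra. -/
noncomputable abbrev fy {n : ℕ} (j : Fin n) : FreeAlgebra ℂ (AffineHeckeGen n) :=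
  FreeAlgebra.ι ℂ (y j)

/-- The generator `(y j)⁻¹` in the free algebra. -/
noncomputable abbrev fyInv {n : ℕ} (j : Fin n) : FreeAlgebra ℂ (AffineHeckeGen n) :=
  FreeAlgebra.ι ℂ (yInv j)

end AffineHeckeGen

open AffineHeckeGen in
/-- The defining relations of `𝓗(n, q)`. -/
inductive AffineHeckeRel (n : ℕ) (q : ℂˣ) :
    FreeAlgebra ℂ (AffineHeckeGen n) → FreeAlgebra ℂ (AffineHeckeGen n) → Prop
  | braid (i : ℕ) (hi : i + 1 + 1 < n) :
      AffineHeckeRel n q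
        (fT i (Nat.lt_of_succ_lt hi) * fT (i + 1) hi * fT i (Nat.lt_of_succ_lt hi))
        (fT (i + 1) hi * fT i (Nat.lt_of_succ_lt hi) * fT (i + 1) hi)
  | quadratic (i : ℕ) (hi : i + 1 < n) :
      AffineHeckeRel n q
        ((fT i hi - algebraMap ℂ _ (q : ℂ)) * (fT i hi + 1)) 0
  | T_comm (i j : ℕ) (hi : i + 1 < n) (hj : j + 1 < n) (hij : i + 1 < j) :
      AffineHeckeRel n q (fT i hi * fT j hj) (fT j hj * fT i hi)
  | y_comm (j l : Fin n) : AffineHeckeRel n q (fy j * fy l) (fy l * fy j)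
  | y_mul_yInv (j : Fin n) : AffineHeckeRel n q (fy j * fyInv j) 1
  | yInv_mul_y (j : Fin n) : AffineHeckeRel n q (fyInv j * fy j) 1
  | T_y_T (i : ℕ) (hi : i + 1 < n) :
      AffineHeckeRel n q
        (fT i hi * fy ⟨i, Nat.lt_of_succ_lt hi⟩ * fT i hi)
        (algebraMap ℂ _ (q : ℂ) * fy ⟨i + 1, hi⟩)
  | T_y_comm (i : ℕ) (hi : i + 1 < n) (j : Fin n) (h₀ : (j : ℕ) ≠ i) (h₁ : (j : ℕ) ≠ i + 1) :
      AffineHeckeRel n q (fT i hi * fy j) (fy j * fT i hi)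

/-- The affine Hecke algebra `𝓗(n, q)` of type A over `ℂ`, by generators and relations. -/
abbrev AffineHecke (n : ℕ) (q : ℂˣ) : Type := RingQuot (AffineHeckeRel n q)

/-- The Hecke algebra `𝓗(n₁, q₁) ⊗ ⋯ ⊗ 𝓗(n_k, q_k)` attached to a Bernstein block. -/
abbrev BlockHecke {k : ℕ} (n : Fin k → ℕ) (q : Fin k → ℂˣ) : Type :=
  ⨂[ℂ] i, AffineHecke (n i) (q i)

/-! ### Completion of modules at an ideal of the centre -/

section Completion

variable {A : Type} [Ring A]

/-- The centre of a ring. -/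
abbrev Zc (A : Type) [Ring A] : Subring A := Subring.center A

instance centerSMulCommClass (M : Type*) [AddCommGroup M] [Module A M] :
    SMulCommClass A (Zc A) M where
  smul_comm a z m := by
    change a • (z : A) • m = (z : A) • a • m
    rw [← mul_smul, ← mul_smul, (Subring.mem_center_iff.mp z.2 a)]

/-- `A`-modules form a category which is linear over the centre of `A`. Through this instance
the groups `Ext` of `A`-modules are modules over the centre. -/
instance centerLinear : Linear (Zc A) (ModuleCat.{0} A) where
  homModule _ _ := inferInstance
  smul_comp _ _ _ z f g := by
    ext m
    change g.hom ((z : A) • f.hom m) = (z : A) • g.hom (f.hom m)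
    rw [map_smul]
  comp_smul _ _ _ _ _ _ := rfl

/-- The `A`-submodule `I M` of `M`, for an ideal `I` of the centre. -/
def centralSMul (I : Ideal (Zc A)) (M : Type*) [AddCommGroup M] [Module A M] :
    Submodule A M where
  carrier := (I • (⊤ : Submodule (Zc A) M) : Submodule (Zc A) M)
  add_mem' := add_mem
  zero_mem' := zero_mem _
  smul_mem' a x hx := by
    refine Submodule.smul_induction_on hx (fun z hz m _ => ?_) (fun x y hx hy => ?_)
    · change a • z • m ∈ _
      rw [smul_comm]
      exact Submodule.smul_mem_smul hz trivial
    · change a • (x + y) ∈ _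
      rw [smul_add]
      exact add_mem hx hy

/-- Multiplication by `a : A`, as a map which is linear over the centre. -/
def mulLeftCenter (a : A) (M : Type*) [AddCommGroup M] [Module A M] : M →ₗ[Zc A] M where
  toFun m := a • m
  map_add' := smul_add a
  map_smul' z m := smul_comm a z m

variable (J : Ideal (Zc A))

/-- The `A`-module structure on `lim M / Jⁱ M`, where `a` acts by multiplication by `a` on each
`M / Jⁱ M`. -/
@[reducible]
noncomputable def completionModule (M : Type*) [AddCommGroup M] [Module A M] :
    Module A (AdicCompletion J M) where
  smul a x := AdicCompletion.map J (mulLeftCenter a M) x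
  one_smul x := by
    change AdicCompletion.map J (mulLeftCenter 1 M) x = x
    have : mulLeftCenter (1 : A) M = LinearMap.id := by ext m; exact one_smul A m
    rw [this, AdicCompletion.map_id]; rfl
  mul_smul a b x := by
    change AdicCompletion.map J (mulLeftCenter (a * b) M) x =
      AdicCompletion.map J (mulLeftCenter a M) (AdicCompletion.map J (mulLeftCenter b M) x)
    rw [AdicCompletion.map_comp_apply]
    congr 2
    ext m
    exact mul_smul a b m
  smul_zero a := map_zero (AdicCompletion.map J (mulLeftCenter a M))
  smul_add a x y := map_add (AdicCompletion.map J (mulLeftCenter a M)) x y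
  add_smul a b x := by
    change AdicCompletion.map J (mulLeftCenter (a + b) M) x =
      AdicCompletion.map J (mulLeftCenter a M) x + AdicCompletion.map J (mulLeftCenter b M) x
    induction x using AdicCompletion.induction_on with
    | h x =>
      rw [AdicCompletion.map_mk, AdicCompletion.map_mk, AdicCompletion.map_mk, ← map_add]
      congr 1
      ext i
      exact add_smul a b (x i)
  zero_smul x := by
    change AdicCompletion.map J (mulLeftCenter 0 M) x = 0
    have : mulLeftCenter (0 : A) M = 0 := by ext m; exact zero_smul A m
    rw [this, AdicCompletion.map_zero]; rfl

/-- The completion `π̂ = lim π / Jⁱ π` as an `A`-module. -/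
noncomputable def completion (M : ModuleCat.{0} A) : ModuleCat.{0} A :=
  letI := completionModule J M
  ModuleCat.of A (AdicCompletion J M)

/-- The completion `Ẑ` of the centre at `J`. -/
abbrev ZHat : Type := AdicCompletion J (Zc A)

/-- The action of `r : Ẑ` on `π̂`, as an endomorphism of the `A`-module `π̂`. -/
noncomputable def completionScalar (M : ModuleCat.{0} A) (r : ZHat J) :
    completion J M ⟶ completion J M :=
  letI := completionModule J M
  ModuleCat.ofHom (X := AdicCompletion J M) (Y := AdicCompletion J M)
    { toFun := fun x => r • x
      map_add' := smul_add r
      map_smul' := fun a x =>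
        ((AdicCompletion.map J (mulLeftCenter a M)).map_smul r x).symm }

/-- The objects of `Ĉ(J)`, regarded as `A`-modules: those of the form `lim τ / Jⁱ τ` for an
`A`-module `τ` all of whose quotients `τ / Jⁱ τ` have finite length. -/
def IsCHat : ObjectProperty (ModuleCat.{0} A) := fun M =>
  ∃ τ : ModuleCat.{0} A, (∀ i : ℕ, IsFiniteLength A (τ ⧸ centralSMul (J ^ i) τ)) ∧
    Nonempty (M ≅ completion J τ)

/-- The category `Ĉ(J)`, a full subcategory of the category of `A`-modules. -/
abbrev CHat : Type 1 := (IsCHat J).FullSubcategory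

/-- The completion of `M` as an object of `Ĉ(J)`. -/
noncomputable abbrev completionObj (M : ModuleCat.{0} A) (h : IsCHat J (completion J M)) :
    CHat J :=
  ⟨completion J M, h⟩

/-- The action of `r : Ẑ` on `π̂`, as an endomorphism in `Ĉ(J)`. -/
noncomputable def completionObjScalar (M : ModuleCat.{0} A) (h : IsCHat J (completion J M))
    (r : ZHat J) : completionObj J M h ⟶ completionObj J M h :=
  ObjectProperty.homMk (completionScalar J M r)

end Completion

/-! The only property of the Hecke algebra `A` that matters is that it is finite over its Noetherian
centre `Z`. The `T i` generate a finite-dimensional algebra and the `y j`, `(y j)⁻¹` a commutative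
one, whose product is everything. The commutative part is integral over the coefficients of `∏ (X -
y j)` and `∏ (X - (y j)⁻¹)`, and these coefficients are central. Only spanning sets are needed, no
basis. Tensor products inherit the property (`isFiniteOverCentral_affineHecke`,
`IsFiniteOverCentral.piTensorProduct`).

For such `A`, `Ĉ(J)` consists of the `A`-modules whose `Z`-action extends to a finite module
structure over the Noetherian ring `Ẑ`. These modules are `J`-adically complete, and `Z`-linear maps
between them are `Ẑ`-linear (`map_zhat_smul`). Hence `Ĉ(J)` is closed under kernels, cokernels and
finite products of modules, and is abelian.

In degree 0, `Ẑ ⊗ Hom(M, N) ≅ Hom(M, N̂)` is checked on free modules and extended by flatness of `Ẑ`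
(`homCompletion_bijective`), while `Hom(M, N̂) ≅ Hom(M̂, N̂)` is the universal property of
completion. Completion is exact on finitely generated modules and sends projectives to projectives
of `Ĉ(J)`, so dimension shifting along free presentations gives all degrees
(`exists_ext_comparison`).

If one argument has finite length and is `J`-adically separated, a power of `J` kills it, hence
kills `Ext`, and base change to `Ẑ` changes nothing. -/

/-! ### Adic completions over Noetherian rings -/

section AdicNoetherian

variable {R : Type*} [CommRing R]

theorem idealOfVars_pow_le_comap_aeval {σ : Type*} (I : Ideal R) (a : σ → R) (ha : ∀ i, a i ∈ I)
    (n : ℕ) : MvPolynomial.idealOfVars σ R ^ n ≤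
      (I ^ n).comap (MvPolynomial.aeval a : MvPolynomial σ R →ₐ[R] R).toRingHom := by
  rw [← Ideal.map_le_iff_le_comap, Ideal.map_pow]
  refine Ideal.pow_right_mono ?_ n
  rw [MvPolynomial.idealOfVars, Ideal.map_span, Ideal.span_le]
  rintro _ ⟨_, ⟨i, rfl⟩, rfl⟩
  simpa using ha i

/-- Evaluation of completed polynomials at elements of `I`, modulo `I ^ n`. -/
noncomputable def evalModPow {σ : Type*} (I : Ideal R) (a : σ → R) (ha : ∀ i, a i ∈ I) (n : ℕ) :
    AdicCompletion (MvPolynomial.idealOfVars σ R) (MvPolynomial σ R) →+* R ⧸ I ^ n :=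
  (Ideal.quotientMap (I ^ n) (MvPolynomial.aeval a).toRingHom
    (idealOfVars_pow_le_comap_aeval I a ha n)).comp
    (AdicCompletion.evalₐ (MvPolynomial.idealOfVars σ R) n).toRingHom

theorem evalModPow_compatible {σ : Type*} (I : Ideal R) (a : σ → R) (ha : ∀ i, a i ∈ I)
    {m n : ℕ} (h : m ≤ n) :
    (Ideal.Quotient.factorPow I h).comp (evalModPow I a ha n) = evalModPow I a ha m := by
  ext x
  induction x using AdicCompletion.induction_on with
  | h x =>
  simp only [evalModPow, RingHom.comp_apply, AlgHom.toRingHom_eq_coe, RingHom.coe_coe,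
    AdicCompletion.evalₐ_mk, Ideal.quotientMap_mk, Ideal.Quotient.factorPow,
    Ideal.Quotient.factor_mk]
  refine Ideal.Quotient.eq.2 ?_
  have := idealOfVars_pow_le_comap_aeval I a ha m
    (Ideal.Quotient.eq.1 (AdicCompletion.Ideal.mk_eq_mk _ h x))
  rw [Ideal.mem_comap, map_sub] at this
  exact this

/-- The ring map from the completed polynomial ring to the completion of `R` at `I` which sends
the variables to the elements `a i` of `I`. -/
noncomputable def evalAdicCompletion {σ : Type*} (I : Ideal R) (a : σ → R) (ha : ∀ i, a i ∈ I) :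
    AdicCompletion (MvPolynomial.idealOfVars σ R) (MvPolynomial σ R) →+* AdicCompletion I R :=
  AdicCompletion.liftRingHom I
    (evalModPow I a ha)
    (evalModPow_compatible I a ha)

theorem evalAdicCompletion_of {σ : Type*} (I : Ideal R) (a : σ → R) (ha : ∀ i, a i ∈ I)
    (p : MvPolynomial σ R) :
    evalAdicCompletion I a ha (AdicCompletion.of _ _ p) =
      AdicCompletion.of I R (MvPolynomial.aeval a p) := by
  refine AdicCompletion.ext_evalₐ fun n => ?_
  rw [evalAdicCompletion, AdicCompletion.evalₐ_liftRingHom]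
  simp [evalModPow, AdicCompletion.evalₐ_of]

/-- The completion of a Noetherian ring is Noetherian. -/
instance AdicCompletion.isNoetherianRing [IsNoetherianRing R] (I : Ideal R) :
    IsNoetherianRing (AdicCompletion I R) := by
  obtain ⟨s, hs⟩ := (isNoetherianRing_iff_ideal_fg R).1 inferInstance I
  let a : s → R := Subtype.val
  have ha : ∀ i, a i ∈ I := fun i => hs ▸ Ideal.subset_span i.2
  let P := AdicCompletion (MvPolynomial.idealOfVars s R) (MvPolynomial s R)
  let K : Ideal P := (MvPolynomial.idealOfVars s R).map (algebraMap _ P)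
  -- `P` is a power series ring in finitely many variables over `R`, hence Noetherian; the goal is
  -- to exhibit the completion of `R` as a quotient of it.
  have hP : IsNoetherianRing P :=
    isNoetherianRing_of_ringEquiv _ (MvPowerSeries.toAdicCompletionAlgEquiv s R).toRingEquiv
  have hK : IsAdicComplete K P := by
    rw [IsAdicComplete.map_algebraMap_iff]
    exact AdicCompletion.isAdicComplete (MvPolynomial.idealOfVars_fg _ _)
  let F := evalAdicCompletion I a ha
  have hKF : K.map F = I.map (algebraMap R (AdicCompletion I R)) := by
    have h1 : K = Ideal.span (Set.range fun i : s =>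
        AdicCompletion.of (MvPolynomial.idealOfVars s R) _ (MvPolynomial.X i)) := by
      have := Ideal.map_span (algebraMap (MvPolynomial s R) P) (Set.range MvPolynomial.X)
      rw [← Set.range_comp] at this
      exact this
    have h2 : I = Ideal.span (Set.range a) := by
      rw [← hs]; simp [a]
    have h3 := congrArg (Ideal.map (algebraMap R (AdicCompletion I R))) h2
    rw [h1, h3, Ideal.map_span, Ideal.map_span, ← Set.range_comp, ← Set.range_comp]
    congr 2
    ext1 i
    refine (evalAdicCompletion_of I a ha _).trans ?_
    rw [MvPolynomial.aeval_X]
    rfl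
  have hH : IsHausdorff (K.map F) (AdicCompletion I R) := by
    rw [hKF, IsHausdorff.map_algebraMap_iff]
    infer_instance
  -- With a complete source and a Hausdorff target, surjectivity modulo `K` suffices. There both
  -- sides reduce to `R ⧸ I`, which constants already fill.
  have hsurj : Function.Surjective F := by
    refine surjective_of_mk_map_comp_surjective (I := K) F fun y => ?_
    obtain ⟨r, rfl⟩ := Ideal.Quotient.mk_surjective y
    obtain ⟨z, hz⟩ := Ideal.Quotient.mk_surjective (AdicCompletion.evalOneₐ I r)
    refine ⟨AdicCompletion.of _ _ (MvPolynomial.C z), ?_⟩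
    rw [RingHom.comp_apply, Ideal.Quotient.eq, hKF,
      ← AdicCompletion.ker_evalOneₐ_eq_map I (show I.FG from ⟨s, hs⟩), RingHom.mem_ker]
    have hF : F (AdicCompletion.of _ _ (MvPolynomial.C z)) = AdicCompletion.of I R z := by
      refine (evalAdicCompletion_of I a ha _).trans ?_
      rw [MvPolynomial.aeval_C]
      rfl
    rw [hF, map_sub, sub_eq_zero]
    exact hz
  exact isNoetherianRing_of_surjective _ _ F hsurj

/-- A finite module over a complete Noetherian ring is complete. -/
theorem IsAdicComplete.of_finite [IsNoetherianRing R] (I : Ideal R) [IsAdicComplete I R]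
    (M : Type*) [AddCommGroup M] [Module R M] [Module.Finite R M] : IsAdicComplete I M := by
  -- Krull's intersection theorem: completeness of `R` puts `I` inside the Jacobson radical.
  have h1 : IsHausdorff I M := IsHausdorff.of_le_jacobson I M (IsAdicComplete.le_jacobson_bot I)
  have h2 : IsPrecomplete I M := by
    rw [← AdicCompletion.of_surjective_iff]
    -- A surjection `Rⁿ → M` stays surjective after completion, and `Rⁿ` is complete coordinate by
    -- coordinate.
    obtain ⟨n, f, hf⟩ := Module.Finite.exists_fin' R M
    intro y
    obtain ⟨x, rfl⟩ := AdicCompletion.map_surjective I hf y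
    choose c hc using fun j => AdicCompletion.of_surjective I R (AdicCompletion.pi I _ x j)
    refine ⟨f c, ?_⟩
    rw [← AdicCompletion.map_of]
    congr 1
    apply (AdicCompletion.piEquivOfFintype I (fun _ : Fin n => R)).injective
    rw [AdicCompletion.piEquivOfFintype_apply, AdicCompletion.piEquivOfFintype_apply]
    ext1 j
    rw [← hc j]
    exact AdicCompletion.map_of ..
  exact { }

/-- Dévissage: `I M` is killed by one power less, and `M / I M` is a finite-dimensional vector space
over `R ⧸ I`. -/
theorem isArtinian_of_pow_smul_eq_bot [IsNoetherianRing R] (I : Ideal R) [hI : I.IsMaximal]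
    (n : ℕ) (M : Type*) [AddCommGroup M] [Module R M] [Module.Finite R M]
    (h : (I ^ n • ⊤ : Submodule R M) = ⊥) : IsArtinian R M := by
  induction n generalizing M with
  | zero =>
    have : Subsingleton M := by
      rw [← Submodule.subsingleton_iff R, ← subsingleton_iff_bot_eq_top]
      simpa using h.symm
    infer_instance
  | succ n ih =>
    rw [isArtinian_iff_submodule_quotient (I • ⊤ : Submodule R M)]
    constructor
    · refine ih _ ?_
      apply Submodule.map_injective_of_injective (Submodule.injective_subtype _)
      rw [Submodule.map_smul'', Submodule.map_top, Submodule.range_subtype, Submodule.map_bot,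
        ← mul_smul, ← pow_succ, h]
    · let _ := Ideal.Quotient.field I
      have : IsScalarTower R (R ⧸ I) (M ⧸ (I • ⊤ : Submodule R M)) := inferInstance
      have : Module.Finite (R ⧸ I) (M ⧸ (I • ⊤ : Submodule R M)) :=
        Module.Finite.of_restrictScalars_finite R _ _
      have h1 : IsArtinian (R ⧸ I) (M ⧸ (I • ⊤ : Submodule R M)) := inferInstance
      exact isArtinian_of_surjective_algebraMap (S := R) (R := R ⧸ I) Ideal.Quotient.mk_surjective

/-- A finite module over a Noetherian ring killed by a power of a maximal ideal is Artinian. -/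
theorem isArtinian_of_pow_smul_eq_zero [IsNoetherianRing R] (I : Ideal R) [hI : I.IsMaximal]
    (n : ℕ) (M : Type*) [AddCommGroup M] [Module R M] [Module.Finite R M]
    (h : ∀ z ∈ I ^ n, ∀ m : M, z • m = 0) : IsArtinian R M :=
  isArtinian_of_pow_smul_eq_bot I n M
    (eq_bot_iff.2 (Submodule.smul_le.2 fun z hz m _ => h z hz m))

end AdicNoetherian

/-! ### The completion functor on modules over a ring finite over its centre -/

theorem map_mem_smul_top {R : Type*} [CommRing R] {M N : Type*} [AddCommGroup M] [AddCommGroup N]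
    [Module R M] [Module R N] (f : M →ₗ[R] N) (I : Ideal R) {x : M}
    (hx : x ∈ (I • ⊤ : Submodule R M)) : f x ∈ (I • ⊤ : Submodule R N) := by
  have := Submodule.mem_map_of_mem (f := f) hx
  rw [Submodule.map_smul''] at this
  exact Submodule.smul_mono le_rfl le_top this

section CompletionFunctor

variable {A : Type} [Ring A] (J : Ideal (Zc A))

/-- The morphism given by a linear map. -/
def homOfLinear {M N : ModuleCat.{0} A} (f : M →ₗ[A] N) : M ⟶ N := ModuleCat.ofHom f

/-- The underlying group of `completion J M`. -/
noncomputable def completionEquiv (M : ModuleCat.{0} A) : completion J M ≃+ AdicCompletion J M :=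
  AddEquiv.refl _

theorem completionEquiv_smul (M : ModuleCat.{0} A) (a : A) (x : completion J M) :
    completionEquiv J M (a • x) =
      AdicCompletion.map J (mulLeftCenter a M) (completionEquiv J M x) := rfl

/-- The `A`-action on a completion is defined through completed endomorphisms; on the centre it must
agree with the intrinsic action, so that `A` and `Ẑ` act compatibly. -/
theorem completionEquiv_center_smul (M : ModuleCat.{0} A) (z : Zc A) (x : completion J M) :
    completionEquiv J M (z • x) = z • completionEquiv J M x := by
  change AdicCompletion.map J (mulLeftCenter (z : A) M) (completionEquiv J M x) = _
  have : mulLeftCenter (z : A) M = z • LinearMap.id := by ext m; rfl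
  rw [this]
  generalize completionEquiv J M x = y
  induction y using AdicCompletion.induction_on with
  | h y => rfl

/-- The underlying module over the centre of `completion J M`. -/
noncomputable def completionLinearEquiv (M : ModuleCat.{0} A) :
    completion J M ≃ₗ[Zc A] AdicCompletion J M :=
  { completionEquiv J M with map_smul' := completionEquiv_center_smul J M }

noncomputable instance completionZHatModule (M : ModuleCat.{0} A) :
    Module (ZHat J) (completion J M) :=
  inferInstanceAs (Module (ZHat J) (AdicCompletion J M))

theorem completionEquiv_zhat_smul (M : ModuleCat.{0} A) (r : ZHat J) (x : completion J M) :
    completionEquiv J M (r • x) = r • completionEquiv J M x := rfl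

/-- `completion J M` as a module over the completed centre. -/
noncomputable def completionZHatEquiv (M : ModuleCat.{0} A) :
    completion J M ≃ₗ[ZHat J] AdicCompletion J M :=
  { completionEquiv J M with map_smul' := completionEquiv_zhat_smul J M }

instance completion_isScalarTower (M : ModuleCat.{0} A) :
    IsScalarTower (Zc A) (ZHat J) (completion J M) where
  smul_assoc z r x := by
    apply (completionEquiv J M).injective
    rw [completionEquiv_zhat_smul, completionEquiv_center_smul, completionEquiv_zhat_smul,
      smul_assoc]

/-- The canonical map from a module to its completion. -/
noncomputable def completionOf (M : ModuleCat.{0} A) : M ⟶ completion J M :=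
  ModuleCat.ofHom (Y := completion J M)
    { toFun := fun m => (completionEquiv J M).symm (AdicCompletion.of J M m)
      map_add' := fun x y => by simp
      map_smul' := fun a x => by
        exact (AdicCompletion.map_of J (mulLeftCenter a M) x).symm }

/-- Every element of the completion is congruent to an element of the module. -/
theorem exists_completionOf_sub_mem (hJ : J.FG) (M : ModuleCat.{0} A) (x : completion J M)
    (n : ℕ) : ∃ m : M, x - (completionOf J M).hom m ∈
      (J ^ n • ⊤ : Submodule (Zc A) (completion J M)) := by
  obtain ⟨m, hm⟩ := Submodule.mkQ_surjective _ (AdicCompletion.eval J M n (completionEquiv J M x))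
  refine ⟨m, ?_⟩
  have h : completionLinearEquiv J M (x - (completionOf J M).hom m) ∈
      (J ^ n • ⊤ : Submodule (Zc A) (AdicCompletion J M)) := by
    rw [AdicCompletion.pow_smul_top_eq_ker_eval hJ, LinearMap.mem_ker, map_sub, map_sub,
      sub_eq_zero]
    exact hm.symm
  exact map_mem_smul_top (completionLinearEquiv J M).symm.toLinearMap _ h

/-- Density of the centre in `Ẑ`. Finite generation of `J` is what identifies the kernel of
evaluation at level `n` with `Jⁿ Ẑ`. -/
theorem exists_algebraMap_sub_mem (hJ : J.FG) (r : ZHat J) (n : ℕ) :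
    ∃ z : Zc A, r - algebraMap (Zc A) (ZHat J) z ∈ (J ^ n • ⊤ : Submodule (Zc A) (ZHat J)) := by
  obtain ⟨z, hz⟩ := Submodule.mkQ_surjective _ (AdicCompletion.eval J (Zc A) n r)
  refine ⟨z, ?_⟩
  rw [AdicCompletion.pow_smul_top_eq_ker_eval hJ, LinearMap.mem_ker, map_sub, sub_eq_zero]
  exact hz.symm

/-- Morphisms of `A`-modules as linear maps over the centre. -/
def centerLinearMap {M N : ModuleCat.{0} A} (f : M ⟶ N) : M →ₗ[Zc A] N where
  toFun := f.hom
  map_add' := map_add f.hom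
  map_smul' z m := f.hom.map_smul (z : A) m

theorem zhat_smul_mem_smul_top {M : Type*} [AddCommGroup M] [Module (Zc A) M] [Module (ZHat J) M]
    [IsScalarTower (Zc A) (ZHat J) M] (n : ℕ) {s : ZHat J}
    (hs : s ∈ (J ^ n • ⊤ : Submodule (Zc A) (ZHat J))) (m : M) :
    s • m ∈ (J ^ n • ⊤ : Submodule (Zc A) M) :=
  map_mem_smul_top ((LinearMap.toSpanSingleton (ZHat J) M m).restrictScalars (Zc A)) (J ^ n) hs

/-- Maps which are linear over the centre into Hausdorff modules are linear over the completed
centre. -/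
theorem map_zhat_smul (hJ : J.FG) {M N : Type*} [AddCommGroup M] [AddCommGroup N]
    [Module (Zc A) M] [Module (Zc A) N] [Module (ZHat J) M] [Module (ZHat J) N]
    [IsScalarTower (Zc A) (ZHat J) M] [IsScalarTower (Zc A) (ZHat J) N] [IsHausdorff J N]
    (f : M →ₗ[Zc A] N) (r : ZHat J) (m : M) : f (r • m) = r • f m := by
  rw [IsHausdorff.eq_iff_smodEq (I := J)]
  intro n
  rw [SModEq.sub_mem]
  obtain ⟨z, hz⟩ := exists_algebraMap_sub_mem J hJ r n
  -- The defect of linearity does not change when a central element is subtracted from `r`, so `r`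
  -- may be replaced by an element of `Jⁿ Ẑ`.
  have h1 : f (r • m) - r • f m = f ((r - algebraMap _ _ z) • m) - (r - algebraMap _ _ z) • f m := by
    rw [sub_smul, sub_smul, map_sub, algebraMap_smul, algebraMap_smul,
      f.map_smul z m]
    abel
  rw [h1]
  exact sub_mem (map_mem_smul_top f _ (zhat_smul_mem_smul_top J n hz m))
    (zhat_smul_mem_smul_top J n hz (f m))

/-- Two morphisms from a completion to a Hausdorff module which agree on the module are equal. -/
theorem completion_hom_ext (hJ : J.FG) {M E : ModuleCat.{0} A} [IsHausdorff J E]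
    {f g : completion J M ⟶ E} (h : completionOf J M ≫ f = completionOf J M ≫ g) : f = g := by
  ext x
  rw [IsHausdorff.eq_iff_smodEq (I := J)]
  intro n
  rw [SModEq.sub_mem]
  obtain ⟨m, hm⟩ := exists_completionOf_sub_mem J hJ M x n
  have h1 : f.hom x - g.hom x =
      centerLinearMap (f - g) (x - (completionOf J M).hom m) := by
    have := congrArg (fun k : M ⟶ E => k.hom m) h
    change f.hom ((completionOf J M).hom m) = g.hom ((completionOf J M).hom m) at this
    change _ = (f - g).hom _
    rw [map_sub]
    simp [this]
  rw [h1]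
  exact map_mem_smul_top _ _ hm

/-- The linear map underlying `completionLift`. -/
noncomputable def completionLiftLinear {M E : ModuleCat.{0} A} [IsAdicComplete J E] (g : M ⟶ E) :
    completion J M →ₗ[A] E :=
    { toFun := fun x => (AdicCompletion.ofLinearEquiv J E).symm
        (AdicCompletion.map J (centerLinearMap g) (completionEquiv J M x))
      map_add' := fun x y => by simp
      map_smul' := fun a x => by
        apply AdicCompletion.of_injective J E
        rw [AdicCompletion.of_ofLinearEquiv_symm, completionEquiv_smul, RingHom.id_apply]
        refine Eq.trans ?_ (AdicCompletion.map_of J (mulLeftCenter a E) _)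
        rw [AdicCompletion.of_ofLinearEquiv_symm, AdicCompletion.map_comp_apply,
          AdicCompletion.map_comp_apply]
        congr 2
        ext m
        exact g.hom.map_smul a m }

/-- The extension to the completion of a morphism to a complete module. -/
noncomputable def completionLift {M E : ModuleCat.{0} A} [IsAdicComplete J E] (g : M ⟶ E) :
    completion J M ⟶ E :=
  homOfLinear (completionLiftLinear J g)

theorem completionOf_comp_lift {M E : ModuleCat.{0} A} [IsAdicComplete J E] (g : M ⟶ E) :
    completionOf J M ≫ completionLift J g = g := by
  ext m
  change (AdicCompletion.ofLinearEquiv J E).symm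
    (AdicCompletion.map J (centerLinearMap g) (AdicCompletion.of J M m)) = _
  rw [AdicCompletion.map_of, AdicCompletion.ofLinearEquiv_symm_of]
  rfl

/-- The linear map underlying `completionMap`. -/
noncomputable def completionMapLinear {M N : ModuleCat.{0} A} (f : M ⟶ N) :
    completion J M →ₗ[A] completion J N :=
    { toFun := fun x => (completionEquiv J N).symm
        (AdicCompletion.map J (centerLinearMap f) (completionEquiv J M x))
      map_add' := fun x y => by simp
      map_smul' := fun a x => by
        apply (completionEquiv J N).injective
        rw [AddEquiv.apply_symm_apply, completionEquiv_smul, RingHom.id_apply, completionEquiv_smul,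
          AddEquiv.apply_symm_apply, AdicCompletion.map_comp_apply, AdicCompletion.map_comp_apply]
        congr 2
        ext m
        exact f.hom.map_smul a m }

/-- The completion of a morphism. -/
noncomputable def completionMap {M N : ModuleCat.{0} A} (f : M ⟶ N) :
    completion J M ⟶ completion J N :=
  homOfLinear (completionMapLinear J f)

theorem completionEquiv_map {M N : ModuleCat.{0} A} (f : M ⟶ N) (x : completion J M) :
    completionEquiv J N ((completionMap J f).hom x) =
      AdicCompletion.map J (centerLinearMap f) (completionEquiv J M x) := rfl

theorem completionOf_comp_map {M N : ModuleCat.{0} A} (f : M ⟶ N) :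
    completionOf J M ≫ completionMap J f = f ≫ completionOf J N := by
  ext m
  exact AdicCompletion.map_of J (centerLinearMap f) m

/-- Completion as a functor. -/
noncomputable def completionFunctor : ModuleCat.{0} A ⥤ ModuleCat.{0} A where
  obj M := completion J M
  map f := completionMap J f
  map_id M := by
    ext x
    apply (completionEquiv J M).injective
    rw [completionEquiv_map]
    exact LinearMap.congr_fun (AdicCompletion.map_id J M) _
  map_comp {M N P} f g := by
    ext x
    apply (completionEquiv J P).injective
    change _ = completionEquiv J P ((completionMap J g).hom ((completionMap J f).hom x))
    rw [completionEquiv_map, completionEquiv_map, completionEquiv_map,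
      AdicCompletion.map_comp_apply]
    rfl

/-! ### Modules of finite length and finite generation over the completed centre -/

theorem mem_centralSMul {I : Ideal (Zc A)} {M : Type*} [AddCommGroup M] [Module A M] {x : M} :
    x ∈ centralSMul I M ↔ x ∈ (I • ⊤ : Submodule (Zc A) M) := Iff.rfl

theorem smul_quotient_centralSMul_eq_zero {I : Ideal (Zc A)} {M : Type*} [AddCommGroup M]
    [Module A M] {z : Zc A} (hz : z ∈ I) (x : M ⧸ centralSMul I M) : z • x = 0 := by
  obtain ⟨m, rfl⟩ := Submodule.Quotient.mk_surjective _ x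
  have h : (z : A) • m ∈ centralSMul I M :=
    mem_centralSMul.2 (Submodule.smul_mem_smul (r := z) hz (Submodule.mem_top (x := m)))
  exact (Submodule.Quotient.mk_eq_zero (centralSMul I M)).2 h

/-- Quotients by powers of a maximal ideal of the centre have finite length if they are finite
over the centre. -/
theorem isFiniteLength_quotient_centralSMul [IsNoetherianRing (Zc A)] [J.IsMaximal] (n : ℕ)
    (M : Type*) [AddCommGroup M] [Module A M]
    [Module.Finite (Zc A) (M ⧸ centralSMul (J ^ n) M)] :
    IsFiniteLength A (M ⧸ centralSMul (J ^ n) M) := by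
  have h1 : IsArtinian (Zc A) (M ⧸ centralSMul (J ^ n) M) :=
    isArtinian_of_pow_smul_eq_zero J n _ fun _ hz x => smul_quotient_centralSMul_eq_zero hz x
  have h2 : IsNoetherian (Zc A) (M ⧸ centralSMul (J ^ n) M) := inferInstance
  rw [isFiniteLength_iff_isNoetherian_isArtinian]
  exact ⟨isNoetherian_of_tower (Zc A) h2, isArtinian_of_tower (Zc A) h1⟩

/-- Modulo `Jⁿ` every scalar of `Ẑ` acts as an element of the centre, so generators over `Ẑ` also
generate the quotient over the centre. -/
theorem finite_quotient_centralSMul (hJ : J.FG) (n : ℕ) (M : Type*) [AddCommGroup M] [Module A M]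
    [Module (ZHat J) M] [IsScalarTower (Zc A) (ZHat J) M] [Module.Finite (ZHat J) M] :
    Module.Finite (Zc A) (M ⧸ centralSMul (J ^ n) M) := by
  obtain ⟨s, hs⟩ := Module.Finite.fg_top (R := ZHat J) (M := M)
  let p : M →ₗ[Zc A] M ⧸ centralSMul (J ^ n) M :=
    { toFun := Submodule.Quotient.mk
      map_add' := fun _ _ => rfl
      map_smul' := fun _ _ => rfl }
  refine ⟨(Submodule.fg_def.2 ⟨p '' s, s.finite_toSet.image _, ?_⟩)⟩
  rw [eq_top_iff]
  rintro x -
  obtain ⟨m, rfl⟩ := Submodule.Quotient.mk_surjective _ x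
  change p m ∈ _
  have hm : m ∈ Submodule.span (ZHat J) (s : Set M) := hs ▸ trivial
  induction hm using Submodule.closure_induction with
  | zero => rw [map_zero]; exact zero_mem _
  | add x y _ _ hx hy => rw [map_add]; exact add_mem hx hy
  | smul_mem r x hx =>
    obtain ⟨z, hz⟩ := exists_algebraMap_sub_mem J hJ r n
    have h1 : p (r • x) = z • p x := by
      rw [← map_smul, ← sub_eq_zero, ← map_sub, ← algebraMap_smul (ZHat J) z x, ← sub_smul]
      exact (Submodule.Quotient.mk_eq_zero _).2 (zhat_smul_mem_smul_top J n hz x)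
    rw [h1]
    exact Submodule.smul_mem _ _ (Submodule.subset_span ⟨x, hx, rfl⟩)

theorem completionOf_bijective (M : ModuleCat.{0} A) [IsAdicComplete J M] :
    Function.Bijective (completionOf J M).hom :=
  AdicCompletion.of_bijective J M

theorem IsCHat.of_iso {M N : ModuleCat.{0} A} (e : M ≅ N) (h : IsCHat J M) : IsCHat J N := by
  obtain ⟨τ, hτ, ⟨f⟩⟩ := h
  exact ⟨τ, hτ, ⟨e.symm ≪≫ f⟩⟩

/-- Lift generators of `M / J M` to a map from a free module `Zⁿ`. It is surjective modulo `J`,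
hence surjective on completions, although it need not be surjective itself. -/
theorem finite_completion_of_finite_quotient (M : ModuleCat.{0} A)
    (h : Module.Finite (Zc A) (M ⧸ (J • ⊤ : Submodule (Zc A) M))) :
    Module.Finite (ZHat J) (completion J M) := by
  obtain ⟨n, f, hf⟩ := Module.Finite.exists_fin' (Zc A) (M ⧸ (J • ⊤ : Submodule (Zc A) M))
  obtain ⟨g, hg⟩ := Module.projective_lifting_property (Submodule.mkQ _) f
    (Submodule.mkQ_surjective _)
  have h1 := AdicCompletion.map_surjective_of_mkQ_comp_surjective (I := J) (f := g)
    (by rw [hg]; exact hf)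
  have : Module.Finite (ZHat J) (AdicCompletion J (Fin n → Zc A)) :=
    have h2 : Module.Finite (ZHat J) (Fin n → ZHat J) := inferInstance
    @Module.Finite.equiv _ _ _ _ _ _ _ _ h2 (AdicCompletion.piEquivFin J n).symm
  have : Module.Finite (ZHat J) (AdicCompletion J M) := Module.Finite.of_surjective _ h1
  exact Module.Finite.equiv (completionZHatEquiv J M).symm

/-- Objects of `Ĉ(J)` are finite modules over the completed centre. -/
theorem IsCHat.exists_module [Module.Finite (Zc A) A] {M : ModuleCat.{0} A} (h : IsCHat J M) :
    ∃ (_ : Module (ZHat J) M), IsScalarTower (Zc A) (ZHat J) M ∧ Module.Finite (ZHat J) M := by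
  obtain ⟨τ, hτ, ⟨e⟩⟩ := h
  -- Level one suffices: `τ / J τ` is finite over `A` because it has finite length, hence finite
  -- over the centre.
  have h1 : Module.Finite (Zc A) (τ ⧸ (J • ⊤ : Submodule (Zc A) τ)) := by
    have h2 := ((isFiniteLength_iff_isNoetherian_isArtinian).1 (hτ 1)).1
    rw [pow_one] at h2
    have : Module.Finite A (τ ⧸ centralSMul J τ) := inferInstance
    have h3 : Module.Finite (Zc A) (τ ⧸ centralSMul J τ) := Module.Finite.trans A _
    let p : (τ ⧸ centralSMul J τ) →ₗ[Zc A] (τ ⧸ (J • ⊤ : Submodule (Zc A) τ)) :=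
      { toFun := Quotient.map' id fun x y hxy => by
          rw [Submodule.quotientRel_def] at hxy ⊢
          exact hxy
        map_add' := by rintro ⟨x⟩ ⟨y⟩; rfl
        map_smul' := by rintro z ⟨x⟩; rfl }
    refine Module.Finite.of_surjective p ?_
    rintro ⟨x⟩
    exact ⟨Submodule.Quotient.mk x, rfl⟩
  have h2 := finite_completion_of_finite_quotient J τ h1
  let E : M ≃+ completion J τ := e.toLinearEquiv.toAddEquiv
  let _ : Module (ZHat J) M := E.module (ZHat J)
  have hE : ∀ (r : ZHat J) (x : M), E (r • x) = r • E x := fun r x => E.apply_symm_apply _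
  refine ⟨inferInstance, ⟨fun z r x => E.injective ?_⟩, ?_⟩
  · rw [hE, smul_assoc, ← hE]
    exact (centerLinearMap e.hom).map_smul z (r • x) |>.symm
  · exact Module.Finite.equiv ({ E with map_smul' := hE } : M ≃ₗ[ZHat J] completion J τ).symm

theorem finite_completion_of_finite [Module.Finite (Zc A) A] (M : ModuleCat.{0} A)
    [Module.Finite A M] : Module.Finite (ZHat J) (completion J M) := by
  have : Module.Finite (Zc A) M := Module.Finite.trans A M
  exact finite_completion_of_finite_quotient J M inferInstance

/-! ### Noetherian centre: finite modules over `Ẑ` are complete and lie in `Ĉ(J)`. -/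

variable [IsNoetherianRing (Zc A)]

theorem isAdicComplete_of_finite_zhat (M : Type*) [AddCommGroup M] [Module (Zc A) M]
    [Module (ZHat J) M] [IsScalarTower (Zc A) (ZHat J) M] [Module.Finite (ZHat J) M] :
    IsAdicComplete J M := by
  have h1 : IsAdicComplete (J.map (algebraMap (Zc A) (ZHat J))) (ZHat J) := by
    rw [IsAdicComplete.map_algebraMap_iff]
    exact AdicCompletion.isAdicComplete (IsNoetherian.noetherian J)
  rw [← IsAdicComplete.map_algebraMap_iff (S := ZHat J)]
  exact IsAdicComplete.of_finite _ M

/-- Such a module is complete, so it can serve as its own `τ`. Together with `IsCHat.exists_module`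
this describes `Ĉ(J)` without completions. -/
theorem isCHat_of_finite_zhat [J.IsMaximal] (M : ModuleCat.{0} A) [Module (ZHat J) M]
    [IsScalarTower (Zc A) (ZHat J) M] [Module.Finite (ZHat J) M] : IsCHat J M := by
  have hJ : J.FG := IsNoetherian.noetherian J
  refine ⟨M, fun n => ?_, ?_⟩
  · have := finite_quotient_centralSMul J hJ n M
    exact isFiniteLength_quotient_centralSMul J n M
  · have := isAdicComplete_of_finite_zhat J M
    have h := (ConcreteCategory.isIso_iff_bijective (completionOf J M)).2
      (completionOf_bijective J M)
    exact ⟨asIso (completionOf J M)⟩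

theorem isCHat_completion [J.IsMaximal] [Module.Finite (Zc A) A] (M : ModuleCat.{0} A)
    [Module.Finite A M] : IsCHat J (completion J M) := by
  have := finite_completion_of_finite J M
  exact isCHat_of_finite_zhat J _

end CompletionFunctor

/-! ### The category `Ĉ(J)` is abelian -/

section CHatAbelian

variable {A : Type} [Ring A] (J : Ideal (Zc A)) [IsNoetherianRing (Zc A)]

theorem IsCHat.isAdicComplete [Module.Finite (Zc A) A] {M : ModuleCat.{0} A} (h : IsCHat J M) :
    IsAdicComplete J M := by
  obtain ⟨_, _, _⟩ := h.exists_module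
  exact isAdicComplete_of_finite_zhat J M

variable [J.IsMaximal]

theorem isCHat_of_addEquiv (M : ModuleCat.{0} A) {F : Type*} [AddCommGroup F] [Module (Zc A) F]
    [Module (ZHat J) F] [IsScalarTower (Zc A) (ZHat J) F] [Module.Finite (ZHat J) F]
    (e : M ≃+ F) (he : ∀ (z : Zc A) (m : M), e (z • m) = z • e m) : IsCHat J M := by
  let _ : Module (ZHat J) M := e.module (ZHat J)
  have hE : ∀ (r : ZHat J) (x : M), e (r • x) = r • e x := fun r x => e.apply_symm_apply _
  have : IsScalarTower (Zc A) (ZHat J) M := ⟨fun z r x => e.injective (by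
    rw [hE, smul_assoc, ← hE, ← he])⟩
  have : Module.Finite (ZHat J) M :=
    Module.Finite.equiv ({ e with map_smul' := hE } : M ≃ₗ[ZHat J] F).symm
  exact isCHat_of_finite_zhat J M

variable [Module.Finite (Zc A) A]

/-- An `A`-linear map between objects of `Ĉ(J)` is automatically `Ẑ`-linear, so its kernel is a
submodule of a finite module over the Noetherian ring `Ẑ`. -/
theorem isCHat_ker {X Y : ModuleCat.{0} A} (f : X ⟶ Y) (hX : IsCHat J X) (hY : IsCHat J Y) :
    IsCHat J (ModuleCat.of A (LinearMap.ker f.hom)) := by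
  have := hY.isAdicComplete J
  obtain ⟨_, _, _⟩ := hX.exists_module
  obtain ⟨_, _, _⟩ := hY.exists_module
  let g : X →ₗ[ZHat J] Y :=
    { centerLinearMap f with
      map_smul' := fun r x => map_zhat_smul J (IsNoetherian.noetherian J) (centerLinearMap f) r x }
  exact isCHat_of_addEquiv J _ (F := LinearMap.ker g)
    { toFun := fun x => ⟨x.1, x.2⟩
      invFun := fun x => ⟨x.1, x.2⟩
      left_inv := fun _ => rfl
      right_inv := fun _ => rfl
      map_add' := fun _ _ => rfl } (fun _ _ => rfl)

theorem isCHat_range_quotient {X Y : ModuleCat.{0} A} (f : X ⟶ Y) (hX : IsCHat J X)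
    (hY : IsCHat J Y) : IsCHat J (ModuleCat.of A (Y ⧸ LinearMap.range f.hom)) := by
  have := hY.isAdicComplete J
  obtain ⟨_, _, _⟩ := hX.exists_module
  obtain ⟨_, _, _⟩ := hY.exists_module
  let g : X →ₗ[ZHat J] Y :=
    { centerLinearMap f with
      map_smul' := fun r x => map_zhat_smul J (IsNoetherian.noetherian J) (centerLinearMap f) r x }
  have hfg : ∀ y : Y, y ∈ LinearMap.range f.hom ↔ y ∈ LinearMap.range g := fun _ => Iff.rfl
  refine isCHat_of_addEquiv J _ (F := Y ⧸ LinearMap.range g)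
    { toFun := Quotient.map' id fun x y hxy => by
        rw [Submodule.quotientRel_def] at hxy ⊢
        exact (hfg _).1 hxy
      invFun := Quotient.map' id fun x y hxy => by
        rw [Submodule.quotientRel_def] at hxy ⊢
        exact (hfg _).2 hxy
      left_inv := ?_
      right_inv := ?_
      map_add' := ?_ } ?_
  · rintro ⟨x⟩; rfl
  · rintro ⟨x⟩; rfl
  · rintro ⟨x⟩ ⟨y⟩; rfl
  · rintro z ⟨x⟩; rfl

theorem isCHat_pi {ι : Type} [Finite ι] (X : ι → ModuleCat.{0} A) (hX : ∀ i, IsCHat J (X i)) :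
    IsCHat J (ModuleCat.of A (∀ i, X i)) := by
  choose _ _ _ using fun i => (hX i).exists_module
  have : IsScalarTower (Zc A) (ZHat J) (∀ i, X i) := Pi.isScalarTower
  exact isCHat_of_addEquiv J _ (AddEquiv.refl (∀ i, X i)) fun _ _ => rfl

instance : (IsCHat J).IsClosedUnderKernels where
  kernels_le := by
    rintro _ ⟨f, k, hk, hf⟩
    exact (isCHat_ker J f hf.1 hf.2).of_iso J
      (Limits.IsLimit.conePointUniqueUpToIso (ModuleCat.kernelIsLimit f) hk)

instance : (IsCHat J).IsClosedUnderCokernels where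
  cokernels_le := by
    rintro _ ⟨f, k, hk, hf⟩
    exact (isCHat_range_quotient J f hf.1 hf.2).of_iso J
      (Limits.IsColimit.coconePointUniqueUpToIso (ModuleCat.cokernelIsColimit f) hk)

instance : (IsCHat J).ContainsZero where
  exists_zero := ⟨ModuleCat.of A PUnit, ModuleCat.isZero_of_subsingleton _,
    isCHat_of_addEquiv J _ (F := PUnit) (AddEquiv.refl PUnit) fun _ _ => rfl⟩

instance : (IsCHat J).IsClosedUnderFiniteProducts where
  isClosedUnderLimitsOfShape ι _ :=
    { limitsOfShape_le := by
        rintro X ⟨p, hp⟩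
        exact (isCHat_pi J _ fun i => hp ⟨i⟩).of_iso J
          (Limits.IsLimit.conePointsIsoOfNatIso p.isLimit
            (ModuleCat.productConeIsLimit fun i => p.diag.obj ⟨i⟩) Discrete.natIsoFunctor).symm }

end CHatAbelian

/-! ### Dimension shifting -/

/-- Isomorphic maps have isomorphic cokernels. This compares `Ext¹`, seen as the cokernel of `Hom(P,
-) → Hom(K, -)`. -/
theorem exists_addEquiv_of_exact {A₁ A₂ A₃ B₁ B₂ B₃ : Type*} [AddCommGroup A₁] [AddCommGroup A₂]
    [AddCommGroup A₃] [AddCommGroup B₁] [AddCommGroup B₂] [AddCommGroup B₃]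
    (f : A₁ →+ A₂) (g : A₂ →+ A₃) (f' : B₁ →+ B₂) (g' : B₂ →+ B₃)
    (hg : Function.Surjective g) (hg' : Function.Surjective g')
    (hfg : Function.Exact f g) (hfg' : Function.Exact f' g')
    (e₁ : A₁ ≃+ B₁) (e₂ : A₂ ≃+ B₂) (h : ∀ a, e₂ (f a) = f' (e₁ a)) :
    ∃ e₃ : A₃ ≃+ B₃, ∀ x, e₃ (g x) = g' (e₂ x) := by
  have hk : g.ker.map e₂.toAddMonoidHom = g'.ker := by
    ext y
    constructor
    · rintro ⟨x, hx, rfl⟩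
      obtain ⟨a, rfl⟩ := (hfg x).1 hx
      exact (hfg' _).2 ⟨e₁ a, (h a).symm⟩
    · intro hy
      obtain ⟨b, rfl⟩ := (hfg' y).1 hy
      refine ⟨f (e₁.symm b), (hfg _).2 ⟨_, rfl⟩, ?_⟩
      exact (h _).trans (by rw [e₁.apply_symm_apply])
  let q := QuotientAddGroup.quotientKerEquivOfSurjective g hg
  let q' := QuotientAddGroup.quotientKerEquivOfSurjective g' hg'
  refine ⟨(q.symm.trans (QuotientAddGroup.congr _ _ e₂ hk)).trans q', fun x => ?_⟩
  have : q.symm (g x) = (x : A₂ ⧸ g.ker) := by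
    rw [AddEquiv.symm_apply_eq]
    rfl
  simp only [AddEquiv.trans_apply, this]
  rfl

section ExtShift

universe w

variable {C : Type*} [Category* C] [Abelian C] [HasExt.{w} C]

/-- Dimension shifting for `Ext` along a short exact sequence with projective middle term. -/
theorem extClass_precomp_bijective {S : ShortComplex C} (hS : S.ShortExact) [Projective S.X₂]
    (Y : C) (i : ℕ) :
    Function.Bijective (hS.extClass.precomp Y (by lia : 1 + (i + 1) = i + 2)) := by
  constructor
  · rw [injective_iff_map_eq_zero]
    intro x hx
    obtain ⟨y, rfl⟩ := Ext.contravariant_sequence_exact₁ hS Y x (by lia : 1 + (i + 1) = i + 2) hx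
    rw [Ext.eq_zero_of_projective y, Ext.comp_zero]
  · intro x
    exact Ext.contravariant_sequence_exact₃ hS Y x (Ext.eq_zero_of_projective _) (by lia)

/-- In the lowest degree the connecting map is only surjective, since `Hom` out of the projective
term need not vanish; the next lemma identifies its kernel. -/
theorem extClass_precomp_surjective {S : ShortComplex C} (hS : S.ShortExact) [Projective S.X₂]
    (Y : C) : Function.Surjective (hS.extClass.precomp Y (add_zero 1)) := fun x =>
  Ext.contravariant_sequence_exact₃ hS Y x (Ext.eq_zero_of_projective _) (add_zero 1)

theorem extClass_precomp_exact {S : ShortComplex C} (hS : S.ShortExact) (Y : C) :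
    Function.Exact ((Ext.mk₀ S.f).precomp Y (zero_add 0)) (hS.extClass.precomp Y (add_zero 1)) := by
  intro x
  constructor
  · intro hx
    exact Ext.contravariant_sequence_exact₁ hS Y x (add_zero 1) hx
  · rintro ⟨y, rfl⟩
    exact hS.extClass_comp_assoc y (h := add_zero 1)

end ExtShift

section ExtComparison

universe w

variable {A : Type} [Ring A]

/-- The finitely generated modules. -/
abbrev FGModules (A : Type) [Ring A] : ObjectProperty (ModuleCat.{0} A) := fun M => Module.Finite A M

/-- Composition with a fixed extension class on the left, linear over the centre. -/
noncomputable def precompCenter {X Y : ModuleCat.{0} A} {n : ℕ} (α : Ext X Y n)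
    (N : ModuleCat.{0} A) {m p : ℕ} (h : n + m = p) : Ext Y N m →ₗ[Zc A] Ext X N p where
  toFun := α.precomp N h
  map_add' := map_add _
  map_smul' z x := Ext.comp_smul α x h z

theorem exists_free_presentation [IsNoetherianRing A] (M : (FGModules A).FullSubcategory) :
    ∃ (K P : (FGModules A).FullSubcategory) (i : K ⟶ P) (p : P ⟶ M) (_ : Module.Free A P.obj),
      Function.Injective i.hom.hom ∧ Function.Exact i.hom.hom p.hom.hom ∧
        Function.Surjective p.hom.hom := by
  have := M.property
  obtain ⟨n, f, hf⟩ := Module.Finite.exists_fin' A M.obj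
  let P : (FGModules A).FullSubcategory :=
    ⟨ModuleCat.of A (Fin n → A), inferInstanceAs (Module.Finite A (Fin n → A))⟩
  let K : (FGModules A).FullSubcategory :=
    ⟨ModuleCat.of A (LinearMap.ker f), inferInstanceAs (Module.Finite A (LinearMap.ker f))⟩
  refine ⟨K, P, ObjectProperty.homMk (ModuleCat.ofHom (LinearMap.ker f).subtype),
    ObjectProperty.homMk (homOfLinear f),
    inferInstanceAs (Module.Free A (Fin n → A)), Subtype.val_injective, ?_, hf⟩
  intro x
  exact ⟨fun hx => ⟨⟨x, hx⟩, rfl⟩, fun ⟨y, hy⟩ => hy ▸ y.2⟩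

theorem shortExact_of_exact {K P M : ModuleCat.{0} A} (i : K ⟶ P) (p : P ⟶ M)
    (hi : Function.Injective i.hom) (hip : Function.Exact i.hom p.hom)
    (hp : Function.Surjective p.hom) :
    ∃ w, (ShortComplex.mk i p w).ShortExact := by
  have w : i ≫ p = 0 := by
    ext x
    exact (hip _).2 ⟨x, rfl⟩
  refine ⟨w, ?_⟩
  have : Mono i := (ModuleCat.mono_iff_injective i).2 hi
  have : Epi p := (ModuleCat.epi_iff_surjective p).2 hp
  exact { exact := (ShortComplex.ShortExact.moduleCat_exact_iff_function_exact _).2 hip }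

/-- A comparison of `Hom` after base change of the centre, for modules over a Noetherian ring,
extends to `Ext` of all degrees. -/
theorem exists_ext_comparison [IsNoetherianRing A] {R : Type} [CommRing R] [Algebra (Zc A) R]
    {D : Type*} [Category* D] [Abelian D] [HasExt.{w} D]
    (F : (FGModules A).FullSubcategory ⥤ D) (N : ModuleCat.{0} A) (Y : D) (σ : R → (Y ⟶ Y))
    (hF : ∀ {K P M : (FGModules A).FullSubcategory} (i : K ⟶ P) (p : P ⟶ M),
      Module.Free A P.obj → Function.Injective i.hom.hom →
      Function.Exact i.hom.hom p.hom.hom → Function.Surjective p.hom.hom →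
      Projective (F.obj P) ∧ ∃ w, (ShortComplex.mk (F.map i) (F.map p) w).ShortExact)
    (c : ∀ M : (FGModules A).FullSubcategory, R ⊗[Zc A] (M.obj ⟶ N) ≃+ (F.obj M ⟶ Y))
    (hc_map : ∀ {M M' : (FGModules A).FullSubcategory} (f : M ⟶ M') (r : R) (g : M'.obj ⟶ N),
      c M (r ⊗ₜ (f.hom ≫ g)) = F.map f ≫ c M' (r ⊗ₜ g))
    (hc_smul : ∀ (M : (FGModules A).FullSubcategory) (r : R) x, c M (r • x) = c M x ≫ σ r)
    (i : ℕ) (M : (FGModules A).FullSubcategory) :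
    ∃ e : R ⊗[Zc A] Ext M.obj N i ≃+ Ext (F.obj M) Y i,
      ∀ (r : R) x, e (r • x) = (e x).comp (Ext.mk₀ (σ r)) (add_zero i) := by
  -- Degree 0 is the hypothesis on `Hom`; its naturality `he₀_map` is needed to pass to cokernels in
  -- degree 1.
  let e₀ (M : (FGModules A).FullSubcategory) : R ⊗[Zc A] Ext M.obj N 0 ≃+ Ext (F.obj M) Y 0 :=
    ((LinearEquiv.baseChange (Zc A) R _ _ (Ext.linearEquiv₀ (R := Zc A))).toAddEquiv.trans
      (c M)).trans Ext.addEquiv₀.symm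
  have he₀ (M : (FGModules A).FullSubcategory) (r : R) (x) :
      e₀ M (r • x) = (e₀ M x).comp (Ext.mk₀ (σ r)) (add_zero 0) := by
    have h : e₀ M (r • x) = Ext.mk₀ (c M (LinearEquiv.baseChange (Zc A) R _ _
        (Ext.linearEquiv₀ (R := Zc A)) (r • x))) := rfl
    rw [h, map_smul, hc_smul, ← Ext.mk₀_comp_mk₀]
    rfl
  have he₀_map {M M' : (FGModules A).FullSubcategory} (f : M ⟶ M') (x) :
      e₀ M ((precompCenter (Ext.mk₀ f.hom) N (zero_add 0)).baseChange R x) =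
        (Ext.mk₀ (F.map f)).precomp Y (zero_add 0) (e₀ M' x) := by
    induction x with
    | zero => simp only [map_zero]
    | add x y hx hy => simp only [map_add, hx, hy]
    | tmul r x =>
      obtain ⟨g, rfl⟩ := (Ext.mk₀_bijective _ _).2 x
      have h (M : (FGModules A).FullSubcategory) (g : M.obj ⟶ N) :
          e₀ M (r ⊗ₜ Ext.mk₀ g) = Ext.mk₀ (c M (r ⊗ₜ g)) := by
        have h1 : e₀ M (r ⊗ₜ Ext.mk₀ g) =
          Ext.mk₀ (c M (r ⊗ₜ Ext.linearEquiv₀ (R := Zc A) (Ext.mk₀ g))) := rfl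
        have h2 : Ext.linearEquiv₀ (R := Zc A) (Ext.mk₀ g) = g :=
          (Ext.mk₀_bijective _ _).1 (Ext.mk₀_linearEquiv₀_apply _)
        rw [h1, h2]
      have h2 : (precompCenter (Ext.mk₀ f.hom) N (zero_add 0)).baseChange R (r ⊗ₜ Ext.mk₀ g) =
          r ⊗ₜ Ext.mk₀ (f.hom ≫ g) := by
        rw [LinearMap.baseChange_tmul]
        congr 1
        exact Ext.mk₀_comp_mk₀ _ _
      rw [h2, h, h, hc_map]
      exact (Ext.mk₀_comp_mk₀ _ _).symm
  induction i generalizing M with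
  | zero => exact ⟨e₀ M, he₀ M⟩
  | succ i ih =>
    obtain ⟨K, P, j, p, hP, hj, hjp, hp⟩ := exists_free_presentation M
    obtain ⟨w, hS⟩ := shortExact_of_exact j.hom p.hom hj hjp hp
    obtain ⟨hFP, w', hS'⟩ := hF j p hP hj hjp hp
    have : Projective P.obj := by
      have := Module.Projective.of_free (R := A) (P := P.obj)
      infer_instance
    have : Projective (ShortComplex.mk j.hom p.hom w).X₂ := ‹Projective P.obj›
    have : Projective (ShortComplex.mk (F.map j) (F.map p) w').X₂ := hFP
    cases i with
    | zero =>
      -- On both sides `Ext¹` is the cokernel of restriction from `P` to `K`; right exactness of the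
      -- tensor product is enough here.
      have hsurj := extClass_precomp_surjective hS N
      obtain ⟨e, he⟩ := exists_addEquiv_of_exact
        ((precompCenter (Ext.mk₀ j.hom) N (zero_add 0)).baseChange R).toAddMonoidHom
        ((precompCenter hS.extClass N (add_zero 1)).baseChange R).toAddMonoidHom
        ((Ext.mk₀ (F.map j)).precomp Y (zero_add 0)) (hS'.extClass.precomp Y (add_zero 1))
        (LinearMap.lTensor_surjective R
          (g := precompCenter hS.extClass N (add_zero 1)) hsurj)
        (extClass_precomp_surjective hS' Y)
        (lTensor_exact R (f := precompCenter (Ext.mk₀ j.hom) N (zero_add 0))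
          (g := precompCenter hS.extClass N (add_zero 1)) (extClass_precomp_exact hS N) hsurj)
        (extClass_precomp_exact hS' Y) (e₀ P) (e₀ K) (he₀_map j)
      refine ⟨e, fun r x => ?_⟩
      obtain ⟨y, rfl⟩ := LinearMap.lTensor_surjective R
        (g := precompCenter hS.extClass N (add_zero 1)) hsurj x
      have h1 := he (r • y)
      have h2 := he y
      change e ((precompCenter hS.extClass N (add_zero 1)).baseChange R (r • y)) = _ at h1
      change e ((precompCenter hS.extClass N (add_zero 1)).baseChange R y) = _ at h2
      rw [map_smul, he₀] at h1
      refine h1.trans ?_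
      refine Eq.trans ?_ (congrArg (fun t => Ext.comp t (Ext.mk₀ (σ r)) (add_zero 1)) h2.symm)
      -- `R` acts by composition on the right and the connecting map by composition on the left, so
      -- they commute by associativity.
      exact (Ext.comp_assoc _ _ _ (add_zero 1) (add_zero 0) (by lia)).symm
    | succ i =>
      -- From degree 2 on, both connecting maps are isomorphisms, and the comparison for the syzygy
      -- `K` one degree lower is transported.
      obtain ⟨e, he⟩ := ih K
      let b := LinearEquiv.ofBijective (precompCenter hS.extClass N (by lia : 1 + (i + 1) = i + 2))
        (extClass_precomp_bijective hS N i)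
      let b' := AddEquiv.ofBijective _ (extClass_precomp_bijective hS' Y i)
      let B := LinearEquiv.baseChange (Zc A) R _ _ b
      refine ⟨(B.symm.toAddEquiv.trans e).trans b', fun r x => ?_⟩
      obtain ⟨y, rfl⟩ := B.surjective x
      have h1 : B.symm (r • B y) = r • y := by
        rw [← map_smul, LinearEquiv.symm_apply_apply]
      change b' (e (B.symm (r • B y))) = (b' (e (B.symm (B y)))).comp _ _
      rw [h1, LinearEquiv.symm_apply_apply, he]
      exact (Ext.comp_assoc hS'.extClass (e y) (Ext.mk₀ (σ r)) (by lia) (add_zero _)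
        (by lia)).symm

end ExtComparison

/-! ### Comparison of `Hom` groups -/

section HomComparison

variable {A : Type} [Ring A] (J : Ideal (Zc A))

/-- Composition with a fixed morphism on the left, linear over the centre. -/
def precompHom {M M' : ModuleCat.{0} A} (f : M ⟶ M') (N : ModuleCat.{0} A) :
    (M' ⟶ N) →ₗ[Zc A] (M ⟶ N) where
  toFun g := f ≫ g
  map_add' _ _ := Preadditive.comp_add ..
  map_smul' _ _ := rfl

/-- The canonical map `Ẑ ⊗ Hom(M, N) → Hom(M, N̂)`. -/
noncomputable def homCompletion (M N : ModuleCat.{0} A) :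
    ZHat J ⊗[Zc A] (M ⟶ N) →ₗ[Zc A] (M ⟶ completion J N) :=
  TensorProduct.lift (LinearMap.mk₂ (Zc A)
    (fun (r : ZHat J) (g : M ⟶ N) => (g ≫ completionOf J N) ≫ completionScalar J N r)
    (fun r s g => by
      ext m
      exact add_smul r s _)
    (fun z r g => by
      ext m
      exact smul_assoc z r ((completionOf J N).hom (g.hom m)))
    (fun r g h => by
      rw [Preadditive.add_comp, Preadditive.add_comp])
    (fun z r g => by
      rw [Linear.smul_comp, Linear.smul_comp]))

theorem homCompletion_tmul (M N : ModuleCat.{0} A) (r : ZHat J) (g : M ⟶ N) :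
    homCompletion J M N (r ⊗ₜ g) = (g ≫ completionOf J N) ≫ completionScalar J N r := rfl

theorem homCompletion_smul (M N : ModuleCat.{0} A) (r : ZHat J) (x : ZHat J ⊗[Zc A] (M ⟶ N)) :
    homCompletion J M N (r • x) = homCompletion J M N x ≫ completionScalar J N r := by
  induction x with
  | zero => simp
  | add x y hx hy => rw [smul_add, map_add, map_add, hx, hy, Preadditive.add_comp]
  | tmul s g =>
    rw [TensorProduct.smul_tmul', homCompletion_tmul, homCompletion_tmul]
    ext m
    exact mul_smul r s _

theorem homCompletion_lTensor {M M' : ModuleCat.{0} A} (f : M ⟶ M') (N : ModuleCat.{0} A)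
    (x : ZHat J ⊗[Zc A] (M' ⟶ N)) :
    homCompletion J M N ((precompHom f N).lTensor (ZHat J) x) = f ≫ homCompletion J M' N x := by
  induction x with
  | zero => simp
  | add x y hx hy => rw [map_add, map_add, map_add, hx, hy, Preadditive.comp_add]
  | tmul s g => rfl

/-- Evaluation of morphisms on a family of elements. -/
def evalHom {ι : Type} {P : ModuleCat.{0} A} (b : ι → P) (N : ModuleCat.{0} A) :
    (P ⟶ N) →ₗ[Zc A] (ι → N) where
  toFun g j := g.hom (b j)
  map_add' _ _ := rfl
  map_smul' _ _ := rfl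

theorem evalHom_bijective {ι : Type} {P : ModuleCat.{0} A} (b : Module.Basis ι A P)
    (N : ModuleCat.{0} A) : Function.Bijective (evalHom b N) := by
  constructor
  · intro f g h
    ext1
    exact b.ext fun i => congrFun h i
  · intro v
    refine ⟨homOfLinear (b.constr ℕ v), ?_⟩
    ext i
    exact b.constr_basis ℕ v i

theorem precompHom_injective {M M' : ModuleCat.{0} A} (f : M ⟶ M') (N : ModuleCat.{0} A)
    (hf : Function.Surjective f.hom) : Function.Injective (precompHom f N) := by
  have : Epi f := (ModuleCat.epi_iff_surjective f).2 hf
  exact fun g h hgh => (cancel_epi f).1 hgh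

theorem exact_precompHom {K P M : ModuleCat.{0} A} (i : K ⟶ P) (p : P ⟶ M) (N : ModuleCat.{0} A)
    (hip : Function.Exact i.hom p.hom) (hp : Function.Surjective p.hom) :
    Function.Exact (precompHom p N) (precompHom i N) := by
  intro g
  constructor
  · intro hg
    have : Epi p := (ModuleCat.epi_iff_surjective p).2 hp
    have w : i ≫ p = 0 := by
      ext x
      exact (hip _).2 ⟨x, rfl⟩
    have hS : (ShortComplex.mk i p w).Exact :=
      (ShortComplex.ShortExact.moduleCat_exact_iff_function_exact _).2 hip
    have : Epi (ShortComplex.mk i p w).g := this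
    exact ⟨hS.desc g hg, hS.g_desc g hg⟩
  · rintro ⟨h, rfl⟩
    ext x
    change h.hom (p.hom (i.hom x)) = 0
    rw [(hip _).2 ⟨x, rfl⟩, map_zero]

variable [IsNoetherianRing (Zc A)] [Module.Finite (Zc A) A]

/-- Evaluation on a basis turns the map into `Ẑ ⊗ Nⁿ → (Nⁿ)^ ≅ N̂ⁿ`, which is bijective because `N`
is finite over the Noetherian centre. -/
theorem homCompletion_bijective_of_free (P N : ModuleCat.{0} A) [Module.Finite A P]
    [Module.Free A P] [Module.Finite A N] : Function.Bijective (homCompletion J P N) := by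
  have hN : Module.Finite (Zc A) N := Module.Finite.trans A N
  obtain ⟨n, ⟨b⟩⟩ : ∃ n : ℕ, Nonempty (Module.Basis (Fin n) A P) := by
    let b := Module.Free.chooseBasis A P
    have : Finite (Module.Free.ChooseBasisIndex A P) := inferInstance
    obtain ⟨n, ⟨e⟩⟩ := Finite.exists_equiv_fin (Module.Free.ChooseBasisIndex A P)
    exact ⟨n, ⟨b.reindex e⟩⟩
  let ev := LinearEquiv.ofBijective _ (evalHom_bijective b N)
  have key : ∀ x, evalHom b (completion J N) (homCompletion J P N x) =
      fun j => (completionEquiv J N).symm (AdicCompletion.pi J (fun _ : Fin n => N)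
        (AdicCompletion.ofTensorProduct J (Fin n → N) (LinearEquiv.lTensor (ZHat J) ev x)) j) := by
    intro x
    induction x with
    | zero => simp only [map_zero]; rfl
    | add x y hx hy => simp only [map_add, hx, hy]; rfl
    | tmul r g =>
      ext j
      have h1 : LinearEquiv.lTensor (ZHat J) ev (r ⊗ₜ[Zc A] g) = r ⊗ₜ (fun j => g.hom (b j)) := rfl
      rw [h1, AdicCompletion.ofTensorProduct_tmul, map_smul]
      have h2 : AdicCompletion.pi J (fun _ : Fin n => N)
          (AdicCompletion.of J (Fin n → N) fun j => g.hom (b j)) j =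
          AdicCompletion.of J N (g.hom (b j)) := AdicCompletion.map_of J _ _
      rw [Pi.smul_apply, h2]
      rfl
  have hb : Function.Bijective (fun x => evalHom b (completion J N) (homCompletion J P N x)) := by
    have e1 := (LinearEquiv.lTensor (ZHat J) ev).bijective
    have e2 := AdicCompletion.ofTensorProduct_bijective_of_finite_of_isNoetherian J (Fin n → N)
    have e3 := (AdicCompletion.piEquivOfFintype J (fun _ : Fin n => N)).bijective
    have e4 := (AddEquiv.piCongrRight fun _ : Fin n => (completionEquiv J N).symm).bijective
    convert e4.comp (e3.comp (e2.comp e1)) using 1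
    ext1 x
    refine (key x).trans ?_
    ext j
    simp only [Function.comp, AddEquiv.piCongrRight_apply]
    congr 1
    exact congrFun (AdicCompletion.piEquivOfFintype_apply J _ _).symm j
  exact (Function.Bijective.of_comp_iff' (evalHom_bijective b (completion J N)) _).1 hb

/-- Compare the left exact sequences of `Hom` for `0 → K → P → M → 0`, using that `Ẑ` is flat.
Injectivity is proved for all finite modules first, since surjectivity for `M` uses injectivity for
`K`. -/
theorem homCompletion_bijective (M N : ModuleCat.{0} A) [hM : Module.Finite A M]
    [Module.Finite A N] : Function.Bijective (homCompletion J M N) := by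
  have : IsNoetherianRing A := isNoetherian_of_tower (Zc A) inferInstance
  have inj (M : (FGModules A).FullSubcategory) :
      Function.Injective (homCompletion J M.obj N) := by
    obtain ⟨K, P, i, p, hP, hi, hip, hp⟩ := exists_free_presentation M
    have := P.property
    have h1 := (homCompletion_bijective_of_free J P.obj N).1
    have h2 := Module.Flat.lTensor_preserves_injective_linearMap (M := ZHat J) _
      (precompHom_injective p.hom N hp)
    rw [injective_iff_map_eq_zero]
    intro x hx
    apply h2
    apply h1
    rw [homCompletion_lTensor, hx, Limits.comp_zero, map_zero, map_zero]
  refine ⟨inj ⟨M, hM⟩, fun h => ?_⟩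
  obtain ⟨K, P, i, p, hP, hi, hip, hp⟩ := exists_free_presentation
    (⟨M, hM⟩ : (FGModules A).FullSubcategory)
  have := P.property
  obtain ⟨y, hy⟩ := (homCompletion_bijective_of_free J P.obj N).2 (p.hom ≫ h)
  have h1 : (precompHom i.hom N).lTensor (ZHat J) y = 0 := by
    apply inj K
    rw [homCompletion_lTensor, hy, map_zero]
    ext x
    change h.hom (p.hom.hom (i.hom.hom x)) = 0
    rw [(hip _).2 ⟨x, rfl⟩, map_zero]
  obtain ⟨x, rfl⟩ := (Module.Flat.lTensor_exact (ZHat J)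
    (exact_precompHom i.hom p.hom N hip hp) y).1 h1
  refine ⟨x, precompHom_injective p.hom _ hp ?_⟩
  rw [homCompletion_lTensor] at hy
  exact hy

end HomComparison

/-! ### Comparison of `Ext` groups -/

section ExtCompletion

variable {A : Type} [Ring A] (J : Ideal (Zc A)) [IsNoetherianRing (Zc A)] [Module.Finite (Zc A) A]

theorem exists_ext_completion_equiv (M N : ModuleCat.{0} A) [hM : Module.Finite A M]
    [Module.Finite A N] (i : ℕ) :
    ∃ e : ZHat J ⊗[Zc A] Ext M N i ≃+ Ext M (completion J N) i, ∀ (r : ZHat J) x,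
      e (r • x) = (e x).comp (Ext.mk₀ (completionScalar J N r)) (add_zero i) := by
  have : IsNoetherianRing A := isNoetherian_of_tower (Zc A) inferInstance
  have hfin (M : (FGModules A).FullSubcategory) : Module.Finite A M.obj := M.property
  refine exists_ext_comparison (FGModules A).ι N (completion J N) (completionScalar J N)
    (fun {K P M} i p hP hi hip hp => ⟨?_, shortExact_of_exact _ _ hi hip hp⟩)
    (fun M => AddEquiv.ofBijective (homCompletion J M.obj N) (homCompletion_bijective J M.obj N))
    (fun f r g => rfl) (fun M r x => homCompletion_smul J M.obj N r x) i ⟨M, hM⟩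
  have := Module.Projective.of_free (R := A) (P := P.obj)
  exact inferInstanceAs (Projective P.obj)

variable [J.IsMaximal]

/-- Completion as a functor from finitely generated modules to `Ĉ(J)`. -/
noncomputable def completionFunctorCHat : (FGModules A).FullSubcategory ⥤ CHat J :=
  (IsCHat J).lift ((FGModules A).ι ⋙ completionFunctor J) fun M =>
    have : Module.Finite A M.obj := M.property
    isCHat_completion J M.obj

/-- Morphisms in `Ĉ(J)` which are short exact on underlying modules form a short exact
sequence. -/
theorem shortExact_chat_of_exact {X Y Z : CHat J} (f : X ⟶ Y) (g : Y ⟶ Z)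
    (hf : Function.Injective f.hom.hom) (hfg : Function.Exact f.hom.hom g.hom.hom)
    (hg : Function.Surjective g.hom.hom) : ∃ w, (ShortComplex.mk f g w).ShortExact := by
  obtain ⟨w, hS⟩ := shortExact_of_exact f.hom g.hom hf hfg hg
  have w' : f ≫ g = 0 := by
    ext1
    exact w
  refine ⟨w', ?_⟩
  have : Mono f := (IsCHat J).ι.mono_of_mono_map ((ModuleCat.mono_iff_injective _).2 hf)
  have : Epi g := (IsCHat J).ι.epi_of_epi_map ((ModuleCat.epi_iff_surjective _).2 hg)
  refine { exact := ShortComplex.exact_of_f_is_kernel _ ?_ }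
  -- Exactness is tested by a kernel, and the full subcategory inclusion reflects limits.
  exact Limits.isLimitOfReflects (IsCHat J).ι ((Limits.KernelFork.isLimitMapConeEquiv _ _).symm
    hS.fIsKernel)

/-- Since `Ĉ(J)` is closed under cokernels of modules, its inclusion preserves epimorphisms. -/
theorem epi_chat_surjective {X Y : CHat J} (f : X ⟶ Y) [Epi f] :
    Function.Surjective f.hom.hom := by
  have := (IsCHat J).preservesEpimorphisms_ι_of_isNormalMonoCategory
  exact (ModuleCat.epi_iff_surjective _).1 (inferInstanceAs (Epi ((IsCHat J).ι.map f)))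

/-- Restrict a map from the completion to `P`, lift it there by projectivity over `A`, and extend
the lift back by completeness of the target. The two maps agree because they agree on `P`. -/
theorem projective_completion (P : ModuleCat.{0} A) [Projective P]
    (h : IsCHat J (completion J P)) : Projective (completionObj J P h) where
  factors {E X} f e he := by
    have hE := E.property.isAdicComplete J
    have hX := X.property.isAdicComplete J
    have he' : Epi e.hom := (ModuleCat.epi_iff_surjective _).2 (epi_chat_surjective J e)
    let g : P ⟶ E.obj := Projective.factorThru (completionOf J P ≫ f.hom) e.hom
    refine ⟨ObjectProperty.homMk (completionLift J g), ?_⟩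
    ext1
    refine completion_hom_ext J (IsNoetherian.noetherian J) ?_
    change completionOf J P ≫ completionLift J g ≫ e.hom = _
    rw [← Category.assoc, completionOf_comp_lift]
    exact Projective.factorThru_comp _ _

/-- Morphisms to a complete module correspond to morphisms from the completion. -/
noncomputable def completionHomEquiv (M E : ModuleCat.{0} A) [IsAdicComplete J E] :
    (M ⟶ E) ≃+ (completion J M ⟶ E) where
  toFun g := completionLift J g
  invFun f := completionOf J M ≫ f
  left_inv g := completionOf_comp_lift J g
  right_inv f := completion_hom_ext J (IsNoetherian.noetherian J) (completionOf_comp_lift J _)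
  map_add' f g := completion_hom_ext J (IsNoetherian.noetherian J) (by
    rw [Preadditive.comp_add]
    simp only [completionOf_comp_lift])

/-- The general comparison is applied to the completion functor; exactness on finite modules over
the Noetherian centre and projectivity of completed free modules are its inputs. -/
theorem exists_ext_chat_equiv [HasExt.{1} (CHat J)] (M N : ModuleCat.{0} A)
    [hM : Module.Finite A M] [Module.Finite A N] (h₁ : IsCHat J (completion J M))
    (h₂ : IsCHat J (completion J N)) (i : ℕ) :
    ∃ e : ZHat J ⊗[Zc A] Ext M N i ≃+ Ext (completionObj J M h₁) (completionObj J N h₂) i,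
      ∀ (r : ZHat J) x,
        e (r • x) = (e x).comp (Ext.mk₀ (completionObjScalar J N h₂ r)) (add_zero i) := by
  have : IsNoetherianRing A := isNoetherian_of_tower (Zc A) inferInstance
  have hfin (M : (FGModules A).FullSubcategory) : Module.Finite A M.obj := M.property
  have hfinZ (M : (FGModules A).FullSubcategory) : Module.Finite (Zc A) M.obj :=
    Module.Finite.trans A M.obj
  have hN := h₂.isAdicComplete J
  refine exists_ext_comparison (completionFunctorCHat J) N (completionObj J N h₂)
    (completionObjScalar J N h₂)
    (fun {K P M} i p hP hi hip hp => ⟨?_, shortExact_chat_of_exact J _ _ ?_ ?_ ?_⟩)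
    (fun M => ((AddEquiv.ofBijective (homCompletion J M.obj N)
      (homCompletion_bijective J M.obj N)).trans (completionHomEquiv J M.obj _)).trans
        { toFun := fun f => ObjectProperty.homMk f
          invFun := fun f => f.hom
          left_inv := fun _ => rfl
          right_inv := fun _ => rfl
          map_add' := fun _ _ => rfl })
    (fun {M M'} f r g => ?_) (fun M r x => ?_) i ⟨M, hM⟩
  · have := Module.Projective.of_free (R := A) (P := P.obj)
    exact projective_completion J P.obj _
  · have := hfinZ P
    exact AdicCompletion.map_injective J (f := centerLinearMap i.hom) hi
  · have := hfinZ P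
    exact AdicCompletion.map_exact (I := J) (f := centerLinearMap i.hom)
      (g := centerLinearMap p.hom) hi hip hp
  · exact AdicCompletion.map_surjective J hp
  · ext1
    refine completion_hom_ext J (IsNoetherian.noetherian J) ?_
    refine (completionOf_comp_lift J _).trans ?_
    change _ = completionOf J M.obj ≫ completionMap J f.hom ≫ completionLift J _
    rw [← Category.assoc, completionOf_comp_map, Category.assoc, completionOf_comp_lift]
    rfl
  · ext1
    refine completion_hom_ext J (IsNoetherian.noetherian J) ?_
    refine (completionOf_comp_lift J _).trans ?_
    change _ = completionOf J M.obj ≫ completionLift J _ ≫ completionScalar J N r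
    rw [← Category.assoc, completionOf_comp_lift]
    exact homCompletion_smul J M.obj N r x

end ExtCompletion

/-! ### Modules killed by a power of the ideal -/

section Torsion

/-- A module killed by a power of `I` is not changed by base change to the completion. -/
theorem tmul_one_bijective_of_pow_smul_eq_zero {R : Type*} [CommRing R] (I : Ideal R) (hI : I.FG)
    {E : Type*} [AddCommGroup E] [Module R E] (m : ℕ) (h : ∀ z ∈ I ^ m, ∀ x : E, z • x = 0) :
    Function.Bijective (TensorProduct.mk R (AdicCompletion I R) E 1) := by
  constructor
  -- `R ⧸ I ^ m` acts on `E`, so evaluation at level `m` gives a retraction of `x ↦ 1 ⊗ x`.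
  · let ψ : (R ⧸ I ^ m) →ₗ[R] E →ₗ[R] E :=
      Submodule.liftQ (I ^ m) (LinearMap.lsmul R E) fun z hz => by
        rw [LinearMap.mem_ker]
        ext x
        exact h z hz x
    let Ψ := TensorProduct.lift (ψ ∘ₗ (AdicCompletion.evalₐ I m).toLinearMap)
    have hΨ : Function.LeftInverse Ψ (TensorProduct.mk R (AdicCompletion I R) E 1) := by
      intro x
      change ψ (AdicCompletion.evalₐ I m 1) x = x
      rw [map_one]
      exact one_smul R x
    exact hΨ.injective
  · intro y
    induction y with
    | zero => exact ⟨0, map_zero _⟩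
    | add y z hy hz =>
      obtain ⟨a, rfl⟩ := hy
      obtain ⟨b, rfl⟩ := hz
      exact ⟨a + b, map_add _ _ _⟩
    | tmul r x =>
      obtain ⟨z, hz⟩ := Submodule.mkQ_surjective _ (AdicCompletion.eval I R m r)
      refine ⟨z • x, ?_⟩
      have hs : r - algebraMap R (AdicCompletion I R) z ∈
          (I ^ m • ⊤ : Submodule R (AdicCompletion I R)) := by
        rw [AdicCompletion.pow_smul_top_eq_ker_eval hI, LinearMap.mem_ker, map_sub, sub_eq_zero]
        exact hz.symm
      have h0 : ∀ s ∈ (I ^ m • ⊤ : Submodule R (AdicCompletion I R)), s ⊗ₜ[R] x = 0 := by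
        intro s hs
        refine Submodule.smul_induction_on hs (fun j hj t _ => ?_) fun s t hs ht => ?_
        · rw [TensorProduct.smul_tmul, h j hj, TensorProduct.tmul_zero]
        · rw [TensorProduct.add_tmul, hs, ht, add_zero]
      have h1 := h0 _ hs
      rw [TensorProduct.sub_tmul, sub_eq_zero] at h1
      rw [h1, TensorProduct.mk_apply, TensorProduct.tmul_smul, TensorProduct.smul_tmul',
        Algebra.algebraMap_eq_smul_one]

variable {A : Type} [Ring A] (J : Ideal (Zc A))

/-- The chain `Jⁿ M` stabilises because `M` is Artinian, and its stable value lies in the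
intersection of all `Jⁿ M`, which is zero. -/
theorem exists_pow_smul_eq_zero {M : ModuleCat.{0} A} [IsHausdorff J M]
    (h : IsFiniteLength A M) : ∃ m : ℕ, ∀ z ∈ J ^ m, ∀ x : M, z • x = 0 := by
  have := (isFiniteLength_iff_isNoetherian_isArtinian.1 h).2
  let f : ℕ →o (Submodule A M)ᵒᵈ :=
    { toFun := fun n => OrderDual.toDual (centralSMul (J ^ n) M)
      monotone' := fun a b hab x hx =>
        (Submodule.smul_mono (Ideal.pow_le_pow_right hab) le_rfl :
          (J ^ b • ⊤ : Submodule (Zc A) M) ≤ J ^ a • ⊤) hx }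
  obtain ⟨m, hm⟩ := IsArtinian.monotone_stabilizes f
  refine ⟨m, fun z hz x => ?_⟩
  have hx : z • x ∈ (J ^ m • ⊤ : Submodule (Zc A) M) := Submodule.smul_mem_smul hz trivial
  refine IsHausdorff.haus (I := J) inferInstance _ fun n => ?_
  rw [SModEq.zero]
  rcases le_total m n with hmn | hmn
  · have h1 : centralSMul (J ^ m) M = centralSMul (J ^ n) M := hm n hmn
    rw [← mem_centralSMul, ← h1]
    exact hx
  · exact (Submodule.smul_mono (Ideal.pow_le_pow_right hmn) le_rfl :
          (J ^ m • ⊤ : Submodule (Zc A) M) ≤ J ^ n • ⊤) hx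

/-- The central action on `Ext` can be computed through either argument, so an element killing one
of the modules kills `Ext`. -/
theorem smul_ext_eq_zero_of_left {M N : ModuleCat.{0} A} {z : Zc A} (h : ∀ x : M, z • x = 0)
    {i : ℕ} (x : Ext M N i) : z • x = 0 := by
  have h1 : z • 𝟙 M = 0 := by
    ext m
    exact h m
  rw [← Ext.mk₀_id_comp x, ← Ext.smul_comp, ← Ext.mk₀_smul, h1, Ext.mk₀_zero, Ext.zero_comp]

theorem smul_ext_eq_zero_of_right {M N : ModuleCat.{0} A} {z : Zc A} (h : ∀ x : N, z • x = 0)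
    {i : ℕ} (x : Ext M N i) : z • x = 0 := by
  have h1 : z • 𝟙 N = 0 := by
    ext m
    exact h m
  rw [Ext.smul_eq_comp_mk₀, h1, Ext.mk₀_zero, Ext.comp_zero]

variable [IsNoetherianRing (Zc A)] [Module.Finite (Zc A) A] [J.IsMaximal]

theorem exists_ext_chat_equiv_of_isFiniteLength [HasExt.{1} (CHat J)] (M N : ModuleCat.{0} A)
    [Module.Finite A M] [Module.Finite A N] (h₁ : IsCHat J (completion J M))
    (h₂ : IsCHat J (completion J N)) (i : ℕ)
    (h : (IsFiniteLength A M ∧ IsCHat J M) ∨ (IsFiniteLength A N ∧ IsCHat J N)) :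
    ∃ e : Ext M N i ≃+ Ext (completionObj J M h₁) (completionObj J N h₂) i,
      ∀ (z : Zc A) x, e (z • x) = (e x).comp
        (Ext.mk₀ (completionObjScalar J N h₂ (algebraMap _ (ZHat J) z))) (add_zero i) := by
  obtain ⟨m, hm⟩ : ∃ m : ℕ, ∀ z ∈ J ^ m, ∀ x : Ext M N i, z • x = 0 := by
    rcases h with ⟨hl, hc⟩ | ⟨hl, hc⟩
    all_goals
      have := hc.isAdicComplete J
      obtain ⟨m, hm⟩ := exists_pow_smul_eq_zero J hl
    · exact ⟨m, fun z hz x => smul_ext_eq_zero_of_left (hm z hz) x⟩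
    · exact ⟨m, fun z hz x => smul_ext_eq_zero_of_right (hm z hz) x⟩
  obtain ⟨e, he⟩ := exists_ext_chat_equiv J M N h₁ h₂ i
  let b := LinearEquiv.ofBijective _
    (tmul_one_bijective_of_pow_smul_eq_zero J (IsNoetherian.noetherian J) m hm)
  refine ⟨b.toAddEquiv.trans e, fun z x => ?_⟩
  change e (b (z • x)) = (e (b x)).comp _ _
  rw [map_smul, ← algebraMap_smul (ZHat J) z (b x), he]

end Torsion

/-! ### Algebras finite over finitely generated central subalgebras -/

section FiniteOverCentral

/-- The algebra `A` is finite over a finitely generated central subalgebra. -/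
def IsFiniteOverCentral (k A : Type*) [CommRing k] [Ring A] [Algebra k A] : Prop :=
  ∃ s t : Set A, s.Finite ∧ t.Finite ∧ s ⊆ Set.center A ∧
    Submodule.span (Algebra.adjoin k s) t = ⊤

theorem adjoin_subset_center {k A : Type*} [CommRing k] [Ring A] [Algebra k A] {s : Set A}
    (hs : s ⊆ Set.center A) : (Algebra.adjoin k s : Set A) ⊆ Set.center A :=
  fun _ hx => Algebra.adjoin_le (S := Subalgebra.center k A) hs hx

theorem IsFiniteOverCentral.module_finite {k A : Type} [CommRing k] [Ring A] [Algebra k A]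
    (h : IsFiniteOverCentral k A) : Module.Finite (Zc A) A := by
  obtain ⟨s, t, -, ht, hsc, hst⟩ := h
  refine ⟨Submodule.fg_def.2 ⟨t, ht, ?_⟩⟩
  rw [eq_top_iff]
  rintro a -
  have ha : a ∈ Submodule.span (Algebra.adjoin k s) t := hst ▸ trivial
  induction ha using Submodule.span_induction with
  | mem x hx => exact Submodule.subset_span hx
  | zero => exact zero_mem _
  | add x y _ _ hx hy => exact add_mem hx hy
  | smul c x _ hx =>
    exact Submodule.smul_mem _ (⟨c, adjoin_subset_center hsc c.2⟩ : Zc A) hx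

/-- An Artin–Tate argument: `A` is a finite module over a polynomial ring mapping to the centre. The
centre is a submodule, hence Noetherian over that ring and a fortiori over itself. -/
theorem IsFiniteOverCentral.isNoetherianRing {k A : Type} [CommRing k] [IsNoetherianRing k]
    [Ring A] [Algebra k A] (h : IsFiniteOverCentral k A) : IsNoetherianRing (Zc A) := by
  obtain ⟨s, t, hs, ht, hsc, hst⟩ := h
  have : Finite s := hs
  let B := MvPolynomial s k
  let f : B →ₐ[k] Subalgebra.center k A := MvPolynomial.aeval fun x => ⟨x.1, hsc x.2⟩
  let φ : B →+* A := (Subalgebra.center k A).val.toRingHom.comp f.toRingHom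
  let φ' : B →+* Zc A := φ.codRestrict (Zc A) fun b => (f b).2
  let _ : Module B A := Module.compHom A φ
  let _ : Module B (Zc A) := Module.compHom (Zc A) φ'
  have hφ : ∀ c ∈ Algebra.adjoin k s, ∃ b : B, φ b = c := by
    intro c hc
    have hle : Algebra.adjoin k s ≤ ((Subalgebra.center k A).val.comp f).range := by
      refine Algebra.adjoin_le fun x hx => ⟨MvPolynomial.X ⟨x, hx⟩, ?_⟩
      change ((f (MvPolynomial.X ⟨x, hx⟩) : Subalgebra.center k A) : A) = x
      rw [MvPolynomial.aeval_X]
    exact hle hc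
  have hfin : Module.Finite B A := by
    refine ⟨Submodule.fg_def.2 ⟨t, ht, ?_⟩⟩
    rw [eq_top_iff]
    rintro a -
    have ha : a ∈ Submodule.span (Algebra.adjoin k s) t := hst ▸ trivial
    induction ha using Submodule.span_induction with
    | mem x hx => exact Submodule.subset_span hx
    | zero => exact zero_mem _
    | add x y _ _ hx hy => exact add_mem hx hy
    | smul c x _ hx =>
      obtain ⟨b, hb⟩ := hφ c c.2
      have : c • x = b • x := by
        change (c : A) * x = φ b * x
        rw [hb]
      rw [this]
      exact Submodule.smul_mem _ b hx
  have : IsNoetherian B A := inferInstance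
  let incl : Zc A →ₗ[B] A :=
    { toFun := fun z => z
      map_add' := fun _ _ => rfl
      map_smul' := fun _ _ => rfl }
  have h1 : IsNoetherian B (Zc A) := isNoetherian_of_injective incl Subtype.val_injective
  have : IsScalarTower B (Zc A) (Zc A) := ⟨fun b x y => mul_assoc (φ' b) x y⟩
  exact isNoetherian_of_tower B h1

theorem IsFiniteOverCentral.piTensorProduct {k : Type*} [CommRing k] {ι : Type*} [Finite ι]
    {A : ι → Type*} [∀ i, Ring (A i)] [∀ i, Algebra k (A i)]
    (h : ∀ i, IsFiniteOverCentral k (A i)) : IsFiniteOverCentral k (⨂[k] i, A i) := by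
  classical
  choose s t hs ht hsc hst using h
  let S : Set (⨂[k] i, A i) := ⋃ i, PiTensorProduct.singleAlgHom (R := k) (A := A) i '' s i
  let τ : Set (⨂[k] i, A i) := PiTensorProduct.tprod k '' (Set.univ.pi t)
  have hsingle : ∀ i, ∀ c ∈ Algebra.adjoin k (s i),
      PiTensorProduct.singleAlgHom (R := k) (A := A) i c ∈ Algebra.adjoin k S := by
    intro i c hc
    have h1 : PiTensorProduct.singleAlgHom (R := k) (A := A) i c ∈
        (Algebra.adjoin k (s i)).map (PiTensorProduct.singleAlgHom i) := ⟨c, hc, rfl⟩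
    rw [AlgHom.map_adjoin] at h1
    exact Algebra.adjoin_mono (Set.subset_iUnion
      (fun i => PiTensorProduct.singleAlgHom (R := k) (A := A) i '' s i) i) h1
  -- `I` is the set of coordinates still allowed to be arbitrary. Enlarging it by `j` expands the
  -- `j`-th factor by multilinearity, its coefficients becoming scalars through `singleAlgHom j`.
  have key : ∀ (I : Finset ι) (x : ∀ i, A i), (∀ i ∉ I, x i ∈ t i) →
      PiTensorProduct.tprod k x ∈ Submodule.span (Algebra.adjoin k S) τ := by
    intro I
    induction I using Finset.induction_on with
    | empty => exact fun x hx => Submodule.subset_span ⟨x, fun i _ => hx i (by simp), rfl⟩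
    | insert j I hj ih =>
      intro x hx
      have h1 : ∀ a ∈ Submodule.span (Algebra.adjoin k (s j)) (t j),
          PiTensorProduct.tprod k (Function.update x j a) ∈
            Submodule.span (Algebra.adjoin k S) τ := by
        intro a ha
        induction ha using Submodule.span_induction with
        | mem a ha =>
          refine ih _ fun i hi => ?_
          by_cases hij : i = j
          · subst hij
            simpa using ha
          · rw [Function.update_of_ne hij]
            exact hx i (by simp [hij, hi])
        | zero =>
          rw [MultilinearMap.map_update_zero]
          exact zero_mem _
        | add a b _ _ ha hb =>
          rw [MultilinearMap.map_update_add]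
          exact add_mem ha hb
        | smul c a _ ha =>
          have h2 : PiTensorProduct.tprod k (Function.update x j (c • a)) =
              PiTensorProduct.singleAlgHom (R := k) (A := A) j c *
                PiTensorProduct.tprod k (Function.update x j a) := by
            rw [PiTensorProduct.singleAlgHom_apply, PiTensorProduct.tprod_mul_tprod]
            congr 1
            ext i
            by_cases hij : i = j
            · subst hij
              simp
              rfl
            · simp [hij]
          rw [h2]
          exact Submodule.smul_mem _ (⟨_, hsingle j c c.2⟩ : Algebra.adjoin k S) ha
      have h3 := h1 (x j) (by rw [hst]; trivial)
      rwa [Function.update_eq_self] at h3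
  refine ⟨S, τ, Set.finite_iUnion fun i => (hs i).image _, (Set.Finite.pi ht).image _, ?_, ?_⟩
  · rintro _ ⟨_, ⟨i, rfl⟩, ⟨z, hz, rfl⟩⟩
    rw [Semigroup.mem_center_iff]
    intro a
    induction a using PiTensorProduct.induction_on with
    | smul_tprod r x =>
      rw [smul_mul_assoc, mul_smul_comm]
      congr 1
      rw [PiTensorProduct.singleAlgHom_apply]
      refine (Commute.tprod ?_).eq
      ext j
      by_cases hij : j = i
      · subst hij
        simpa using Semigroup.mem_center_iff.1 (hsc j hz) (x j)
      · simp [hij]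
    | add a b ha hb => rw [add_mul, mul_add, ha, hb]
  · rw [eq_top_iff]
    rintro a -
    have := Fintype.ofFinite ι
    induction a using PiTensorProduct.induction_on with
    | smul_tprod r x =>
      rw [← algebraMap_smul (Algebra.adjoin k S) r]
      exact Submodule.smul_mem _ _ (key Finset.univ x (by simp))
    | add a b ha hb => exact add_mem ha hb

end FiniteOverCentral

/-! ### The finite Hecke algebra is finite-dimensional -/

section FiniteHecke

variable {k H : Type*} [Field k] [Ring H] [Algebra k H] (T : ℕ → H)

variable (k) in
/-- The subalgebra generated by `T 0, …, T (m - 1)`. -/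
def heckeSub (m : ℕ) : Subalgebra k H := Algebra.adjoin k (T '' Set.Iio m)

theorem heckeSub_mono {m m' : ℕ} (h : m ≤ m') : heckeSub k T m ≤ heckeSub k T m' :=
  Algebra.adjoin_mono (Set.image_mono (Set.Iio_subset_Iio h))

theorem mem_heckeSub {i m : ℕ} (h : i < m) : T i ∈ heckeSub k T m :=
  Algebra.subset_adjoin ⟨i, h, rfl⟩

variable (k) in
/-- The submodule `H_m + H_m T_m H_m`. -/
def heckeStep (m : ℕ) : Submodule k H :=
  Subalgebra.toSubmodule (heckeSub k T m) ⊔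
    Subalgebra.toSubmodule (heckeSub k T m) * Submodule.span k {T m} *
      Subalgebra.toSubmodule (heckeSub k T m)

theorem heckeSub_le_heckeStep {m : ℕ} {x : H} (hx : x ∈ heckeSub k T m) : x ∈ heckeStep k T m :=
  Submodule.mem_sup_left hx

theorem mul_mul_mem_heckeStep {m : ℕ} {a b : H} (ha : a ∈ heckeSub k T m)
    (hb : b ∈ heckeSub k T m) : a * T m * b ∈ heckeStep k T m :=
  Submodule.mem_sup_right (Submodule.mul_mem_mul
    (Submodule.mul_mem_mul ha (Submodule.mem_span_singleton_self _)) hb)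

theorem heckeStep_induction {m : ℕ} {p : H → Prop} (hadd : ∀ x y, p x → p y → p (x + y))
    (h₁ : ∀ x ∈ heckeSub k T m, p x)
    (h₂ : ∀ a ∈ heckeSub k T m, ∀ b ∈ heckeSub k T m, p (a * T m * b)) {x : H}
    (hx : x ∈ heckeStep k T m) : p x := by
  obtain ⟨u, hu, v, hv, rfl⟩ := Submodule.mem_sup.1 hx
  refine hadd _ _ (h₁ u hu) ?_
  refine Submodule.mul_induction_on hv (fun c hc b hb => ?_) hadd
  refine Submodule.mul_induction_on (C := fun c => p (c * b)) hc (fun a ha t ht => ?_)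
    fun x y hx hy => by rw [add_mul]; exact hadd _ _ hx hy
  obtain ⟨r, rfl⟩ := Submodule.mem_span_singleton.1 ht
  rw [mul_smul_comm, smul_mul_assoc, ← mul_smul_comm]
  exact h₂ a ha _ (Subalgebra.smul_mem _ hb r)

variable {N : ℕ} {q : k}

theorem commute_of_mem_heckeSub (hcomm : ∀ i j, i + 1 < j → j < N → T i * T j = T j * T i)
    {m j : ℕ} (hmj : m < j) (hj : j < N) {x : H} (hx : x ∈ heckeSub k T m) :
    x * T j = T j * x := by
  induction hx using Algebra.adjoin_induction with
  | mem x hx =>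
    obtain ⟨i, hi, rfl⟩ := hx
    exact hcomm i j (by have : i < m := hi; lia) hj
  | algebraMap r => exact Algebra.commutes r _
  | add x y _ _ hx hy => rw [add_mul, mul_add, hx, hy]
  | mul x y _ _ hx hy => rw [mul_assoc, hy, ← mul_assoc, hx, mul_assoc]

/-- `H_m + H_m T_m H_m` contains 1, and the hypothesis makes it stable under right multiplication by
`T 0, …, T m`. -/
theorem heckeSub_succ_le_of_mul_mem {m : ℕ}
    (h : ∀ x ∈ heckeSub k T m, T m * x * T m ∈ heckeStep k T m) {x : H}
    (hx : x ∈ heckeSub k T (m + 1)) : x ∈ heckeStep k T m := by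
  have hmul : ∀ w ∈ heckeStep k T m, w * x ∈ heckeStep k T m := by
    induction hx using Algebra.adjoin_induction with
    | mem x hx =>
      obtain ⟨i, hi, rfl⟩ := hx
      intro w hw
      refine heckeStep_induction T (p := fun w => w * T i ∈ heckeStep k T m)
        (fun x y hx hy => by rw [add_mul]; exact add_mem hx hy) (fun a ha => ?_)
        (fun a ha b hb => ?_) hw
      all_goals
        rcases (Nat.lt_succ_iff_lt_or_eq.1 hi) with hi | rfl
      · exact heckeSub_le_heckeStep T (mul_mem ha (mem_heckeSub T hi))
      · simpa using mul_mul_mem_heckeStep T ha (one_mem (heckeSub k T i))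
      · rw [mul_assoc]
        exact mul_mul_mem_heckeStep T ha (mul_mem hb (mem_heckeSub T hi))
      · have h1 := h b hb
        have h2 : a * T i * b * T i = a * (T i * b * T i) := by noncomm_ring
        rw [h2]
        refine heckeStep_induction T (p := fun w => a * w ∈ heckeStep k T i)
          (fun x y hx hy => by rw [mul_add]; exact add_mem hx hy)
          (fun x hx => heckeSub_le_heckeStep T (mul_mem ha hx)) (fun c hc d hd => ?_) h1
        rw [← mul_assoc, ← mul_assoc]
        exact mul_mul_mem_heckeStep T (mul_mem ha hc) hd
    | algebraMap r =>
      intro w hw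
      rw [← Algebra.commutes, ← Algebra.smul_def]
      exact Submodule.smul_mem _ r hw
    | add x y _ _ hx hy =>
      intro w hw
      rw [mul_add]
      exact add_mem (hx w hw) (hy w hw)
    | mul x y _ _ hx hy =>
      intro w hw
      rw [← mul_assoc]
      exact hy _ (hx w hw)
  simpa using hmul 1 (heckeSub_le_heckeStep T (one_mem _))

/-- By induction the middle factor is in `H_m` or of the form `a T_m b` with `a`, `b` in `H_m`.
Since `H_m` commutes with `T (m + 1)`, the quadratic relation settles the first case, and the braid
relation leaves a single `T (m + 1)` in the second. -/
theorem mul_mul_mem_heckeStep_of_relations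
    (hquad : ∀ i < N, T i * T i = (q - 1) • T i + q • 1)
    (hbraid : ∀ i, i + 1 < N → T i * T (i + 1) * T i = T (i + 1) * T i * T (i + 1))
    (hcomm : ∀ i j, i + 1 < j → j < N → T i * T j = T j * T i) :
    ∀ m < N, ∀ x ∈ heckeSub k T m, T m * x * T m ∈ heckeStep k T m := by
  intro m
  have hsq : ∀ m < N, ∀ x ∈ heckeSub k T m, x * (T m * T m) ∈ heckeStep k T m := by
    intro m hm x hx
    rw [hquad m hm, mul_add, mul_smul_comm, mul_smul_comm, mul_one]
    refine add_mem (Submodule.smul_mem _ _ ?_) (Submodule.smul_mem _ _ (heckeSub_le_heckeStep T hx))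
    simpa using mul_mul_mem_heckeStep T hx (one_mem (heckeSub k T m))
  induction m with
  | zero =>
    intro hm x hx
    have h0 : heckeSub k T 0 = ⊥ := by
      rw [heckeSub]
      simp
    obtain ⟨r, rfl⟩ := Algebra.mem_bot.1 (h0 ▸ hx)
    rw [← Algebra.commutes, mul_assoc]
    exact hsq 0 hm _ hx
  | succ m ih =>
    intro hm x hx
    have hx' := heckeSub_succ_le_of_mul_mem T (ih (by lia)) hx
    have hc : ∀ a ∈ heckeSub k T m, a * T (m + 1) = T (m + 1) * a := fun a ha =>
      commute_of_mem_heckeSub T hcomm (Nat.lt_succ_self m) hm ha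
    have hle : ∀ a ∈ heckeSub k T m, a ∈ heckeSub k T (m + 1) := fun a ha =>
      heckeSub_mono T (Nat.le_succ m) ha
    refine heckeStep_induction T (p := fun w => T (m + 1) * w * T (m + 1) ∈ heckeStep k T (m + 1))
      (fun x y hx hy => by rw [mul_add, add_mul]; exact add_mem hx hy) (fun a ha => ?_)
      (fun a ha b hb => ?_) hx'
    · rw [← hc a ha, mul_assoc]
      exact hsq _ hm a (hle a ha)
    · have h1 : T (m + 1) * (a * T m * b) * T (m + 1) =
          (a * T m) * T (m + 1) * (T m * b) := by
        calc T (m + 1) * (a * T m * b) * T (m + 1)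
            = (T (m + 1) * a) * T m * (b * T (m + 1)) := by noncomm_ring
          _ = a * (T (m + 1) * T m * T (m + 1)) * b := by rw [← hc a ha, hc b hb]; noncomm_ring
          _ = (a * T m) * T (m + 1) * (T m * b) := by rw [← hbraid m hm]; noncomm_ring
      rw [h1]
      have hT : T m ∈ heckeSub k T (m + 1) := mem_heckeSub T (Nat.lt_succ_self m)
      exact mul_mul_mem_heckeStep T (mul_mem (hle a ha) hT) (mul_mem hT (hle b hb))

/-- The subalgebra generated by elements satisfying the relations of the Hecke algebra of the
symmetric group is finite-dimensional. -/
theorem heckeSub_fg (hquad : ∀ i < N, T i * T i = (q - 1) • T i + q • 1)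
    (hbraid : ∀ i, i + 1 < N → T i * T (i + 1) * T i = T (i + 1) * T i * T (i + 1))
    (hcomm : ∀ i j, i + 1 < j → j < N → T i * T j = T j * T i) :
    ∀ m ≤ N, (Subalgebra.toSubmodule (heckeSub k T m)).FG := by
  intro m
  induction m with
  | zero =>
    intro _
    have h0 : heckeSub k T 0 = ⊥ := by
      rw [heckeSub]
      simp
    rw [h0, Algebra.toSubmodule_bot, Submodule.one_eq_span]
    exact Submodule.fg_span_singleton _
  | succ m ih =>
    intro hm
    have h1 := ih (by lia)
    refine Submodule.FG.of_le ((h1.sup ((h1.mul (Submodule.fg_span_singleton (T m))).mul h1)) :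
      (heckeStep k T m).FG) fun x hx => ?_
    exact heckeSub_succ_le_of_mul_mem T
      (mul_mul_mem_heckeStep_of_relations T hquad hbraid hcomm m (by lia)) hx

end FiniteHecke

/-! ### Finiteness from integrality -/

section Integrality

open Polynomial

/-- The coefficients of `∏ (X - Y j)` commute with `t` if `t` commutes with the symmetric
functions of two of the `Y j` and with the other ones. -/
theorem commute_coeff_prod {k B H : Type*} [Field k] [CommRing B] [Algebra k B] [Ring H]
    [Algebra k H] (φ : B →ₐ[k] H) {n : ℕ} (Y : Fin n → B) (t : H) {a b : Fin n} (hab : a ≠ b)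
    (hadd : t * φ (Y a + Y b) = φ (Y a + Y b) * t) (hmul : t * φ (Y a * Y b) = φ (Y a * Y b) * t)
    (hother : ∀ j, j ≠ a → j ≠ b → t * φ (Y j) = φ (Y j) * t) (i : ℕ) :
    t * φ ((∏ j, (X - C (Y j))).coeff i) = φ ((∏ j, (X - C (Y j))).coeff i) * t := by
  -- `Q` collects the elements whose image commutes with `t`. The product has coefficients in `Q`
  -- once its factors at `a` and `b` are multiplied together.
  let Q : Subalgebra k B := (Subalgebra.centralizer k {t}).comap φ
  have hQ : ∀ x : B, x ∈ Q ↔ t * φ x = φ x * t := fun x => by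
    simp [Q, Subalgebra.mem_centralizer_iff]
  have hlift : ∏ j, (X - C (Y j)) ∈ liftsRing Q.val.toRingHom := by
    have hC : ∀ x : B, t * φ x = φ x * t → C x ∈ liftsRing Q.val.toRingHom := fun x hx =>
      (lifts_iff_liftsRing _ _).1 (C'_mem_lifts ⟨⟨x, (hQ x).2 hx⟩, rfl⟩)
    have hX : (X : B[X]) ∈ liftsRing Q.val.toRingHom := (lifts_iff_liftsRing _ _).1 (X_mem_lifts _)
    rw [← Finset.mul_prod_erase _ _ (Finset.mem_univ a),
      ← Finset.mul_prod_erase _ _ (Finset.mem_erase.2 ⟨hab.symm, Finset.mem_univ b⟩), ← mul_assoc]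
    refine mul_mem ?_ (prod_mem fun j hj => ?_)
    · have h1 : (X - C (Y a)) * (X - C (Y b)) = X * X - C (Y a + Y b) * X + C (Y a * Y b) := by
        rw [C_add, C_mul]
        ring
      rw [h1]
      exact add_mem (sub_mem (mul_mem hX hX) (mul_mem (hC _ hadd) hX)) (hC _ hmul)
    · rw [Finset.mem_erase, Finset.mem_erase] at hj
      exact sub_mem hX (hC _ (hother j hj.2.1 hj.1))
  obtain ⟨x, hx⟩ := (lifts_iff_coeff_lifts _).1 ((lifts_iff_liftsRing _ _).2 hlift) i
  rw [← hx]
  exact (hQ _).1 x.2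

theorem isIntegral_of_coeff_mem {k B : Type*} [Field k] [CommRing B] [Algebra k B] {n : ℕ}
    (Y : Fin n → B) (S : Subalgebra k B) (hS : ∀ i, (∏ j, (X - C (Y j))).coeff i ∈ S) (j : Fin n) :
    IsIntegral S (Y j) := by
  have hmonic : (∏ j, (X - C (Y j))).Monic := monic_prod_of_monic _ _ fun j _ => monic_X_sub_C _
  have hlift : ∏ j, (X - C (Y j)) ∈ lifts (algebraMap S B) :=
    (lifts_iff_coeff_lifts _).2 fun i => ⟨⟨_, hS i⟩, rfl⟩
  obtain ⟨p, hp, -, hpm⟩ := lifts_and_natDegree_eq_and_monic hlift hmonic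
  refine ⟨p, hpm, ?_⟩
  rw [eval₂_eq_eval_map, hp, eval_prod]
  exact Finset.prod_eq_zero (Finset.mem_univ j) (by simp)

theorem finite_of_adjoin_eq_top {k B : Type*} [Field k] [CommRing B] [Algebra k B]
    (S : Subalgebra k B) {s : Set B} (hs : s.Finite) (hadj : Algebra.adjoin k s = ⊤)
    (hint : ∀ x ∈ s, IsIntegral S x) : Module.Finite S B := by
  have h1 := Algebra.finite_adjoin_of_finite_of_isIntegral hs hint
  have h2 : Algebra.adjoin S s = ⊤ := by
    rw [eq_top_iff]
    rintro x -
    have hx : x ∈ Algebra.adjoin k s := hadj ▸ trivial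
    have hle : Algebra.adjoin k s ≤ (Algebra.adjoin S s).restrictScalars k :=
      Algebra.adjoin_le Algebra.subset_adjoin
    exact hle hx
  rw [h2] at h1
  exact Module.Finite.equiv (Subalgebra.topEquiv (R := S) (A := B)).toLinearEquiv

/-- If `H` is the product of a finite-dimensional subspace and a commutative subalgebra finite
over a central subalgebra, then `H` is finite over this central subalgebra. -/
theorem IsFiniteOverCentral.of_mul_eq_top {k B H : Type*} [Field k] [CommRing B] [Algebra k B]
    [Ring H] [Algebra k H] (φ : B →ₐ[k] H) {s : Set B} (hs : s.Finite)
    (hc : ∀ x ∈ s, φ x ∈ Set.center H) (hfin : Module.Finite (Algebra.adjoin k s) B)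
    (V : Submodule k H) (hV : V.FG) (hVB : V * Subalgebra.toSubmodule φ.range = ⊤) :
    IsFiniteOverCentral k H := by
  obtain ⟨t₁, ht₁, hVt⟩ := Submodule.fg_def.1 hV
  obtain ⟨t₂, ht₂, hBt⟩ := Submodule.fg_def.1 hfin.fg_top
  have hsc : φ '' s ⊆ Set.center H := by
    rintro _ ⟨x, hx, rfl⟩
    exact hc x hx
  refine ⟨φ '' s, Set.image2 (fun h b => h * φ b) t₁ t₂, hs.image _, ht₁.image2 _ ht₂, hsc, ?_⟩
  rw [eq_top_iff]
  rintro x -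
  have hx : x ∈ V * Subalgebra.toSubmodule φ.range := hVB ▸ trivial
  refine Submodule.mul_induction_on hx (fun h hh c hc => ?_) fun x y hx hy => add_mem hx hy
  obtain ⟨b, rfl⟩ := hc
  change h * φ b ∈ _
  have hb : b ∈ Submodule.span (Algebra.adjoin k s) t₂ := hBt ▸ trivial
  rw [← hVt] at hh
  induction hh using Submodule.span_induction with
  | zero => rw [zero_mul]; exact zero_mem _
  | add x y _ _ hx hy => rw [add_mul]; exact add_mem hx hy
  | smul r x _ hx =>
    rw [smul_mul_assoc, ← algebraMap_smul (Algebra.adjoin k (φ '' s)) r]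
    exact Submodule.smul_mem _ _ hx
  | mem h hh =>
    induction hb using Submodule.span_induction with
    | zero => rw [map_zero, mul_zero]; exact zero_mem _
    | add x y _ _ hx hy => rw [map_add, mul_add]; exact add_mem hx hy
    | mem b hb => exact Submodule.subset_span ⟨h, hh, b, hb, rfl⟩
    | smul c b _ hb =>
      have hc' : φ c ∈ Algebra.adjoin k (φ '' s) := by
        rw [← AlgHom.map_adjoin]
        exact ⟨c, c.2, rfl⟩
      -- Centrality of `φ c` lets it cross `h` and become a scalar on the left.
      have h1 : h * φ (c • b) = φ c * (h * φ b) := by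
        have h2 := Semigroup.mem_center_iff.1 (adjoin_subset_center hsc hc') h
        rw [Algebra.smul_def, map_mul, ← mul_assoc, ← mul_assoc, ← h2]
        rfl
      rw [h1]
      exact Submodule.smul_mem _ (⟨φ c, hc'⟩ : Algebra.adjoin k (φ '' s)) hb

end Integrality

/-! ### The affine Hecke algebra is finite over a central subalgebra -/

theorem mul_self_eq_of_quadratic {k H : Type*} [CommRing k] [Ring H] [Algebra k H] {t : H} {q : k}
    (h : (t - algebraMap k H q) * (t + 1) = 0) : t * t = (q - 1) • t + q • 1 := by
  rw [Algebra.algebraMap_eq_smul_one, sub_mul, mul_add, mul_one, smul_mul_assoc, one_mul, smul_add,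
    sub_eq_zero, ← eq_sub_iff_add_eq] at h
  rw [h, sub_smul, one_smul]
  abel

section AffineHeckeRelations

variable (n : ℕ) (q : ℂˣ)

/-- The generator `T i`, or `0` if `i` is out of range. -/
noncomputable def heckeT (i : ℕ) : AffineHecke n q :=
  if h : i + 1 < n then RingQuot.mkAlgHom ℂ (AffineHeckeRel n q) (AffineHeckeGen.fT i h) else 0

/-- The generator `y j`. -/
noncomputable def heckeY (j : Fin n) : AffineHecke n q :=
  RingQuot.mkAlgHom ℂ (AffineHeckeRel n q) (AffineHeckeGen.fy j)

/-- The generator `(y j)⁻¹`. -/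
noncomputable def heckeYInv (j : Fin n) : AffineHecke n q :=
  RingQuot.mkAlgHom ℂ (AffineHeckeRel n q) (AffineHeckeGen.fyInv j)

variable {n}

theorem heckeT_of_lt {i : ℕ} (h : i + 1 < n) :
    heckeT n q i = RingQuot.mkAlgHom ℂ (AffineHeckeRel n q) (AffineHeckeGen.fT i h) :=
  dif_pos h

theorem heckeT_sq {i : ℕ} (h : i + 1 < n) :
    heckeT n q i * heckeT n q i = ((q : ℂ) - 1) • heckeT n q i + (q : ℂ) • 1 := by
  have h1 := RingQuot.mkAlgHom_rel ℂ (AffineHeckeRel.quadratic (q := q) i h)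
  rw [map_mul, map_sub, map_add, map_one, map_zero, AlgHom.commutes, ← heckeT_of_lt q h] at h1
  exact mul_self_eq_of_quadratic h1

theorem heckeT_braid {i : ℕ} (h : i + 1 + 1 < n) :
    heckeT n q i * heckeT n q (i + 1) * heckeT n q i =
      heckeT n q (i + 1) * heckeT n q i * heckeT n q (i + 1) := by
  have h1 := RingQuot.mkAlgHom_rel ℂ (AffineHeckeRel.braid (q := q) i h)
  simpa only [map_mul, ← heckeT_of_lt] using h1

theorem heckeT_comm {i j : ℕ} (hij : i + 1 < j) (h : j + 1 < n) :
    heckeT n q i * heckeT n q j = heckeT n q j * heckeT n q i := by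
  have h1 := RingQuot.mkAlgHom_rel ℂ
    (AffineHeckeRel.T_comm (q := q) i j (by lia : i + 1 < n) h hij)
  simpa only [map_mul, ← heckeT_of_lt] using h1

theorem heckeY_comm (j l : Fin n) : heckeY n q j * heckeY n q l = heckeY n q l * heckeY n q j := by
  have h1 := RingQuot.mkAlgHom_rel ℂ (AffineHeckeRel.y_comm (q := q) j l)
  rw [map_mul, map_mul] at h1
  exact h1

theorem heckeY_mul_inv (j : Fin n) : heckeY n q j * heckeYInv n q j = 1 := by
  have h1 := RingQuot.mkAlgHom_rel ℂ (AffineHeckeRel.y_mul_yInv (q := q) j)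
  rw [map_mul, map_one] at h1
  exact h1

theorem heckeYInv_mul (j : Fin n) : heckeYInv n q j * heckeY n q j = 1 := by
  have h1 := RingQuot.mkAlgHom_rel ℂ (AffineHeckeRel.yInv_mul_y (q := q) j)
  rw [map_mul, map_one] at h1
  exact h1

theorem heckeT_Y_T {i : ℕ} (h : i + 1 < n) :
    heckeT n q i * heckeY n q ⟨i, Nat.lt_of_succ_lt h⟩ * heckeT n q i =
      (q : ℂ) • heckeY n q ⟨i + 1, h⟩ := by
  have h1 := RingQuot.mkAlgHom_rel ℂ (AffineHeckeRel.T_y_T (q := q) i h)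
  rw [map_mul, map_mul, map_mul, AlgHom.commutes, ← heckeT_of_lt q h, ← Algebra.smul_def] at h1
  exact h1

theorem heckeT_Y_comm {i : ℕ} (h : i + 1 < n) (j : Fin n) (h₀ : (j : ℕ) ≠ i)
    (h₁ : (j : ℕ) ≠ i + 1) : heckeT n q i * heckeY n q j = heckeY n q j * heckeT n q i := by
  have h1 := RingQuot.mkAlgHom_rel ℂ (AffineHeckeRel.T_y_comm (q := q) i h j h₀ h₁)
  rw [map_mul, map_mul, ← heckeT_of_lt] at h1
  exact h1

/-- The units `y j`. -/
noncomputable def heckeYUnit (j : Fin n) : (AffineHecke n q)ˣ :=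
  ⟨heckeY n q j, heckeYInv n q j, heckeY_mul_inv q j, heckeYInv_mul q j⟩

theorem heckeY_inv_comm (j l : Fin n) :
    heckeY n q j * heckeYInv n q l = heckeYInv n q l * heckeY n q j :=
  (show Commute (heckeY n q j) (heckeYUnit q l : AffineHecke n q) from
    heckeY_comm q j l).units_inv_right

theorem heckeYInv_comm (j l : Fin n) :
    heckeYInv n q j * heckeYInv n q l = heckeYInv n q l * heckeYInv n q j :=
  (show Commute ((heckeYUnit q l)⁻¹ : (AffineHecke n q)ˣ).1 (heckeYUnit q j : AffineHecke n q) from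
    (heckeY_inv_comm q j l).symm).units_inv_right.symm

theorem heckeT_YInv_comm {i : ℕ} (h : i + 1 < n) (j : Fin n) (h₀ : (j : ℕ) ≠ i)
    (h₁ : (j : ℕ) ≠ i + 1) :
    heckeT n q i * heckeYInv n q j = heckeYInv n q j * heckeT n q i :=
  (show Commute (heckeT n q i) (heckeYUnit q j : AffineHecke n q) from
    heckeT_Y_comm q h j h₀ h₁).units_inv_right

/-- Multiply `T y T = q y'` by `T` on the left, expand `T²`, and cancel the invertible `q`;
multiplication on the right gives the companion relation. -/
theorem heckeY_mul_T_left {i : ℕ} (h : i + 1 < n) :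
    heckeY n q ⟨i, Nat.lt_of_succ_lt h⟩ * heckeT n q i =
      heckeT n q i * heckeY n q ⟨i + 1, h⟩ - ((q : ℂ) - 1) • heckeY n q ⟨i + 1, h⟩ := by
  have h1 := congrArg (fun x => heckeT n q i * x) (heckeT_Y_T q h)
  simp only [← mul_assoc, heckeT_sq q h, add_mul, smul_mul_assoc, one_mul, mul_smul_comm] at h1
  rw [mul_assoc (heckeT n q i), ← mul_assoc (heckeT n q i), heckeT_Y_T q h] at h1
  apply (smul_right_injective (AffineHecke n q) q.ne_zero)
  change (q : ℂ) • _ = (q : ℂ) • _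
  rw [smul_sub, ← h1, smul_comm (q : ℂ) ((q : ℂ) - 1)]
  abel

theorem heckeY_mul_T_right {i : ℕ} (h : i + 1 < n) :
    heckeY n q ⟨i + 1, h⟩ * heckeT n q i =
      heckeT n q i * heckeY n q ⟨i, Nat.lt_of_succ_lt h⟩ +
        ((q : ℂ) - 1) • heckeY n q ⟨i + 1, h⟩ := by
  have h1 := congrArg (fun x => x * heckeT n q i) (heckeT_Y_T q h)
  simp only [mul_assoc, heckeT_sq q h, mul_add, smul_mul_assoc, mul_one, mul_smul_comm] at h1
  rw [← mul_assoc (heckeT n q i), heckeT_Y_T q h] at h1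
  apply (smul_right_injective (AffineHecke n q) q.ne_zero)
  change (q : ℂ) • _ = (q : ℂ) • _
  rw [smul_add, ← h1, smul_comm (q : ℂ) ((q : ℂ) - 1)]
  abel

/-- Multiply the relation for `y` by the two inverses, one on each side. The outcome has the same
shape with the two indices exchanged. -/
theorem heckeYInv_mul_T_left {i : ℕ} (h : i + 1 < n) :
    heckeYInv n q ⟨i, Nat.lt_of_succ_lt h⟩ * heckeT n q i =
      heckeT n q i * heckeYInv n q ⟨i + 1, h⟩ +
        ((q : ℂ) - 1) • heckeYInv n q ⟨i, Nat.lt_of_succ_lt h⟩ := by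
  have h1 := heckeY_mul_T_left q h
  generalize heckeT n q i = t at *
  have ha := heckeYInv_mul q (⟨i, Nat.lt_of_succ_lt h⟩ : Fin n)
  have hb := heckeY_mul_inv q (⟨i + 1, h⟩ : Fin n)
  generalize heckeYInv n q ⟨i, Nat.lt_of_succ_lt h⟩ = a' at *
  generalize heckeYInv n q ⟨i + 1, h⟩ = b' at *
  generalize heckeY n q ⟨i, Nat.lt_of_succ_lt h⟩ = a at *
  generalize heckeY n q ⟨i + 1, h⟩ = b at *
  calc a' * t = a' * (t * b) * b' := by rw [mul_assoc, mul_assoc, hb, mul_one]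
    _ = a' * (a * t + ((q : ℂ) - 1) • b) * b' := by rw [h1]; congr 2; abel
    _ = (a' * a) * t * b' + ((q : ℂ) - 1) • (a' * (b * b')) := by
      rw [mul_add, add_mul, mul_smul_comm, smul_mul_assoc]
      simp only [mul_assoc]
    _ = _ := by rw [ha, hb, one_mul, mul_one]

theorem heckeYInv_mul_T_right {i : ℕ} (h : i + 1 < n) :
    heckeYInv n q ⟨i + 1, h⟩ * heckeT n q i =
      heckeT n q i * heckeYInv n q ⟨i, Nat.lt_of_succ_lt h⟩ -
        ((q : ℂ) - 1) • heckeYInv n q ⟨i, Nat.lt_of_succ_lt h⟩ := by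
  have h1 := heckeY_mul_T_right q h
  generalize heckeT n q i = t at *
  have ha := heckeY_mul_inv q (⟨i, Nat.lt_of_succ_lt h⟩ : Fin n)
  have hb := heckeYInv_mul q (⟨i + 1, h⟩ : Fin n)
  generalize heckeYInv n q ⟨i, Nat.lt_of_succ_lt h⟩ = a' at *
  generalize heckeYInv n q ⟨i + 1, h⟩ = b' at *
  generalize heckeY n q ⟨i, Nat.lt_of_succ_lt h⟩ = a at *
  generalize heckeY n q ⟨i + 1, h⟩ = b at *
  calc b' * t = b' * (t * a) * a' := by rw [mul_assoc, mul_assoc, ha, mul_one]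
    _ = b' * (b * t - ((q : ℂ) - 1) • b) * a' := by rw [h1]; congr 2; abel
    _ = (b' * b) * t * a' - ((q : ℂ) - 1) • ((b' * b) * a') := by
      rw [mul_sub, sub_mul, mul_smul_comm, smul_mul_assoc]
      simp only [mul_assoc]
    _ = _ := by rw [hb, one_mul, one_mul]

variable (n)

theorem adjoin_hecke_generators_eq_top :
    Algebra.adjoin ℂ (heckeT n q '' Set.Iio (n - 1) ∪
      (Set.range (heckeY n q) ∪ Set.range (heckeYInv n q))) = ⊤ := by
  have h1 := congrArg (Subalgebra.map (RingQuot.mkAlgHom ℂ (AffineHeckeRel n q)))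
    (FreeAlgebra.adjoin_range_ι ℂ (AffineHeckeGen n))
  rw [AlgHom.map_adjoin, Algebra.map_top,
    (AlgHom.range_eq_top _).2 (RingQuot.mkAlgHom_surjective ℂ (AffineHeckeRel n q))] at h1
  rw [eq_top_iff, ← h1]
  refine Algebra.adjoin_mono ?_
  rintro _ ⟨_, ⟨g, rfl⟩, rfl⟩
  cases g with
  -- With truncated subtraction, `i < n - 1` is equivalent to `i + 1 < n` even for `n = 0`.
  | T i hi => exact Or.inl ⟨i, (by lia : i < n - 1), heckeT_of_lt q hi⟩
  | y j => exact Or.inr (Or.inl ⟨j, rfl⟩)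
  | yInv j => exact Or.inr (Or.inr ⟨j, rfl⟩)

end AffineHeckeRelations

open scoped IsMulCommutative in
/-- A set of commuting elements generates the image of a commutative algebra. -/
theorem exists_commutative_model {k H : Type} [Field k] [Ring H] [Algebra k H] (s : Set H)
    (hs : ∀ x ∈ s, ∀ y ∈ s, x * y = y * x) :
    ∃ (B : Type) (_ : CommRing B) (_ : Algebra k B) (φ : B →ₐ[k] H) (ψ : s → B),
      (∀ x, φ (ψ x) = x) ∧ Algebra.adjoin k (Set.range ψ) = ⊤ := by
  have := Algebra.isMulCommutative_adjoin k hs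
  refine ⟨Algebra.adjoin k s, inferInstance, inferInstance, (Algebra.adjoin k s).val,
    fun x => ⟨x, Algebra.subset_adjoin x.2⟩, fun _ => rfl, ?_⟩
  rw [← Algebra.adjoin_adjoin_coe_preimage]
  congr 1
  ext x
  constructor
  · rintro ⟨y, rfl⟩
    exact y.2
  · exact fun hx => ⟨⟨x, hx⟩, rfl⟩

/-! ### Moving the `T i` past the commutative part, and finiteness of the affine Hecke algebra. -/

section CrossRelations

open Polynomial

/-- A form of `commute_coeff_prod` in which `t` and the `φ (Y j)` satisfy the cross relations of an
affine Hecke algebra. -/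
theorem commute_coeff_prod_of_cross {k B H : Type*} [Field k] [CommRing B] [Algebra k B] [Ring H]
    [Algebra k H] (φ : B →ₐ[k] H) {n : ℕ} (Y : Fin n → B) (t : H) {a b : Fin n} (hab : a ≠ b)
    {c : k} (ha : φ (Y a) * t = t * φ (Y b) - c • φ (Y b))
    (hb : φ (Y b) * t = t * φ (Y a) + c • φ (Y b))
    (hother : ∀ j, j ≠ a → j ≠ b → t * φ (Y j) = φ (Y j) * t) (i : ℕ) :
    t * φ ((∏ j, (X - C (Y j))).coeff i) = φ ((∏ j, (X - C (Y j))).coeff i) * t := by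
  refine commute_coeff_prod φ Y t hab ?_ ?_ hother i
  · rw [map_add, add_mul, ha, hb, mul_add]
    abel
  · calc t * φ (Y a * Y b) = t * φ (Y b) * φ (Y a) := by
          rw [mul_comm (Y a), map_mul, mul_assoc]
      _ = (φ (Y a) * t + c • φ (Y b)) * φ (Y a) := by rw [ha, sub_add_cancel]
      _ = φ (Y a) * (t * φ (Y a) + c • φ (Y b)) := by
          rw [add_mul, mul_add, mul_assoc, smul_mul_assoc, mul_smul_comm, ← map_mul, ← map_mul,
            mul_comm (Y a) (Y b)]
      _ = φ (Y a * Y b) * t := by rw [← hb, map_mul, mul_assoc]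

/-- If moving `t` past the generators of `B` to the left produces elements of `t B + B`, then so
does moving `t` past any element of `B`. -/
theorem exists_mul_eq_mul_add {k B H : Type*} [Field k] [CommRing B] [Algebra k B] [Ring H]
    [Algebra k H] (φ : B →ₐ[k] H) (t : H) {s : Set B} (hs : Algebra.adjoin k s = ⊤)
    (h : ∀ x ∈ s, ∃ b c, φ x * t = t * φ b + φ c) (x : B) : ∃ b c, φ x * t = t * φ b + φ c := by
  have hx : x ∈ Algebra.adjoin k s := hs ▸ trivial
  induction hx using Algebra.adjoin_induction with
  | mem x hx => exact h x hx
  | algebraMap r =>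
    refine ⟨algebraMap k B r, 0, ?_⟩
    rw [AlgHom.commutes, map_zero, add_zero, Algebra.commutes]
  | add x y _ _ hx hy =>
    obtain ⟨b, c, hx⟩ := hx
    obtain ⟨b', c', hy⟩ := hy
    refine ⟨b + b', c + c', ?_⟩
    rw [map_add, add_mul, hx, hy, map_add, map_add, mul_add]
    abel
  | mul x y _ _ hx hy =>
    obtain ⟨b, c, hx⟩ := hx
    obtain ⟨b', c', hy⟩ := hy
    -- Move `t` past `y` first, leaving `φ x * φ c'`, then past `x`, leaving `φ c * φ b'`.
    refine ⟨b * b', c * b' + x * c', ?_⟩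
    rw [map_mul, mul_assoc, hy, mul_add, ← mul_assoc, hx, map_add, map_mul, map_mul, map_mul,
      add_mul, mul_assoc, add_assoc]

/-- The product contains 1 and is stable under right multiplication by the generators: those in `s`
are absorbed by the range of `φ`, and those in `τ` are moved left past it. -/
theorem mul_range_eq_top {k B H : Type*} [Field k] [CommRing B] [Algebra k B] [Ring H]
    [Algebra k H] (φ : B →ₐ[k] H) {τ s : Set H}
    (hs : s ⊆ φ.range) (htop : Algebra.adjoin k (τ ∪ s) = ⊤)
    (h : ∀ t ∈ τ, ∀ x, ∃ b c, φ x * t = t * φ b + φ c) :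
    Subalgebra.toSubmodule (Algebra.adjoin k τ) * Subalgebra.toSubmodule φ.range = ⊤ := by
  set V := Subalgebra.toSubmodule (Algebra.adjoin k τ) with hV
  set W := V * Subalgebra.toSubmodule φ.range with hW
  rw [eq_top_iff]
  rintro x -
  have hx : x ∈ Algebra.adjoin k (τ ∪ s) := htop ▸ trivial
  have hmul : ∀ w ∈ W, w * x ∈ W := by
    induction hx using Algebra.adjoin_induction with
    | mem x hx =>
      intro w hw
      refine Submodule.mul_induction_on hw (fun v hv p hp => ?_)
        fun y z hy hz => by rw [add_mul]; exact add_mem hy hz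
      obtain ⟨b, rfl⟩ := hp
      change v * φ b * x ∈ W
      rw [mul_assoc]
      rcases hx with hx | hx
      · obtain ⟨c, d, hcd⟩ := h x hx b
        rw [hcd, mul_add, ← mul_assoc]
        exact add_mem (Submodule.mul_mem_mul (mul_mem hv (Algebra.subset_adjoin hx) :
          v * x ∈ Algebra.adjoin k τ) ⟨c, rfl⟩) (Submodule.mul_mem_mul hv ⟨d, rfl⟩)
      · exact Submodule.mul_mem_mul hv (mul_mem ⟨b, rfl⟩ (hs hx) : φ b * x ∈ φ.range)
    | algebraMap r =>
      intro w hw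
      rw [← Algebra.commutes, ← Algebra.smul_def]
      exact Submodule.smul_mem _ r hw
    | add x y _ _ hx hy =>
      intro w hw
      rw [mul_add]
      exact add_mem (hx w hw) (hy w hw)
    | mul x y _ _ hx hy =>
      intro w hw
      rw [← mul_assoc]
      exact hy _ (hx w hw)
  have h1 : (1 : H) ∈ W := by
    rw [← one_mul (1 : H)]
    exact Submodule.mul_mem_mul (one_mem (Algebra.adjoin k τ)) (one_mem φ.range)
  simpa using hmul 1 h1

/-- An affine Hecke algebra is finite over the symmetric functions in `y j` and `(y j)⁻¹`. -/
theorem isFiniteOverCentral_affineHecke (n : ℕ) (q : ℂˣ) :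
    IsFiniteOverCentral ℂ (AffineHecke n q) := by
  obtain ⟨B, _, _, φ, ψ, hψ, htop⟩ := exists_commutative_model (k := ℂ)
    (Set.range (heckeY n q) ∪ Set.range (heckeYInv n q)) (by
      rintro _ (⟨j, rfl⟩ | ⟨j, rfl⟩) _ (⟨l, rfl⟩ | ⟨l, rfl⟩)
      · exact heckeY_comm q j l
      · exact heckeY_inv_comm q j l
      · exact (heckeY_inv_comm q l j).symm
      · exact heckeYInv_comm q j l)
  let Y : Fin n → B := fun j => ψ ⟨heckeY n q j, Or.inl ⟨j, rfl⟩⟩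
  let Y' : Fin n → B := fun j => ψ ⟨heckeYInv n q j, Or.inr ⟨j, rfl⟩⟩
  have hY : ∀ j, φ (Y j) = heckeY n q j := fun j => hψ _
  have hY' : ∀ j, φ (Y' j) = heckeYInv n q j := fun j => hψ _
  have hgen : ∀ x ∈ Set.range ψ, (∃ j, x = Y j) ∨ ∃ j, x = Y' j := by
    rintro _ ⟨⟨_, ⟨j, rfl⟩ | ⟨j, rfl⟩⟩, rfl⟩
    · exact Or.inl ⟨j, rfl⟩
    · exact Or.inr ⟨j, rfl⟩
  have hfingen : (Set.range ψ).Finite := by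
    refine ((Set.finite_range Y).union (Set.finite_range Y')).subset fun x hx => ?_
    rcases hgen x hx with ⟨j, rfl⟩ | ⟨j, rfl⟩
    · exact Or.inl ⟨j, rfl⟩
    · exact Or.inr ⟨j, rfl⟩
  have hval : ∀ {i : ℕ} (h : i + 1 < n) (j : Fin n), j ≠ ⟨i, Nat.lt_of_succ_lt h⟩ →
      j ≠ ⟨i + 1, h⟩ → (j : ℕ) ≠ i ∧ (j : ℕ) ≠ i + 1 := fun h j h₀ h₁ =>
    ⟨fun e => h₀ (Fin.ext e), fun e => h₁ (Fin.ext e)⟩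
  have hrange : (Set.range (heckeY n q) ∪ Set.range (heckeYInv n q)) ⊆ φ.range := by
    rintro _ (⟨j, rfl⟩ | ⟨j, rfl⟩)
    · exact ⟨Y j, hY j⟩
    · exact ⟨Y' j, hY' j⟩
  -- Both families are included so that each `y j` and each `(y j)⁻¹` is a root of a monic
  -- polynomial with coefficients in the subalgebra generated by `s`.
  let s : Set B := Set.range (∏ j, (X - C (Y j))).coeff ∪ Set.range (∏ j, (X - C (Y' j))).coeff
  have hsT : ∀ i < n - 1, ∀ x ∈ s, heckeT n q i * φ x = φ x * heckeT n q i := by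
    intro i hi
    have h : i + 1 < n := by lia
    have hne : (⟨i, Nat.lt_of_succ_lt h⟩ : Fin n) ≠ ⟨i + 1, h⟩ := fun e => by
      simpa using congrArg Fin.val e
    rintro _ (⟨m, rfl⟩ | ⟨m, rfl⟩)
    · refine commute_coeff_prod_of_cross φ Y _ hne (c := (q : ℂ) - 1) ?_ ?_
        (fun j h₀ h₁ => ?_) m
      · rw [hY, hY]
        exact heckeY_mul_T_left q h
      · rw [hY, hY]
        exact heckeY_mul_T_right q h
      · rw [hY]
        exact heckeT_Y_comm q h j (hval h j h₀ h₁).1 (hval h j h₀ h₁).2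
    -- For the inverses, `i + 1` and `i` play the roles of `a` and `b` in this order.
    · refine commute_coeff_prod_of_cross φ Y' _ hne.symm (c := (q : ℂ) - 1) ?_ ?_
        (fun j h₁ h₀ => ?_) m
      · rw [hY', hY']
        exact heckeYInv_mul_T_right q h
      · rw [hY', hY']
        exact heckeYInv_mul_T_left q h
      · rw [hY']
        exact heckeT_YInv_comm q h j (hval h j h₀ h₁).1 (hval h j h₀ h₁).2
  refine IsFiniteOverCentral.of_mul_eq_top φ (s := s)
    ((finite_range_coeff _).union (finite_range_coeff _)) (fun x hx => ?_)
    (finite_of_adjoin_eq_top _ hfingen htop fun x hx => ?_)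
    (Subalgebra.toSubmodule (heckeSub ℂ (heckeT n q) (n - 1)))
    (heckeSub_fg (N := n - 1) (q := (q : ℂ)) (heckeT n q) (fun i hi => heckeT_sq q (by lia))
      (fun i hi => heckeT_braid q (by lia)) (fun i j hij hj => heckeT_comm q hij (by lia))
      (n - 1) le_rfl)
    (mul_range_eq_top φ hrange (adjoin_hecke_generators_eq_top n q) ?_)
  -- It is enough to commute with generators: with the `T i` by `hsT`, with the others because they
  -- lie in the commutative image of `φ`.
  · rw [Semigroup.mem_center_iff]
    intro g
    have hg : g ∈ Algebra.adjoin ℂ (heckeT n q '' Set.Iio (n - 1) ∪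
        (Set.range (heckeY n q) ∪ Set.range (heckeYInv n q))) := by
      rw [adjoin_hecke_generators_eq_top]
      trivial
    refine (Algebra.commute_of_mem_adjoin_of_forall_mem_commute hg fun b hb => ?_).eq.symm
    rcases hb with ⟨i, hi, rfl⟩ | hb
    · exact (hsT i hi x hx).symm
    · obtain ⟨y, rfl⟩ := hrange hb
      exact (Commute.all x y).map φ
  · rcases hgen x hx with ⟨j, rfl⟩ | ⟨j, rfl⟩
    · exact isIntegral_of_coeff_mem Y _
        (fun i => Algebra.subset_adjoin (Or.inl ⟨i, rfl⟩)) j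
    · exact isIntegral_of_coeff_mem Y' _
        (fun i => Algebra.subset_adjoin (Or.inr ⟨i, rfl⟩)) j
  · rintro _ ⟨i, hi, rfl⟩
    have h : i + 1 < n := by have : i < n - 1 := hi; lia
    refine exists_mul_eq_mul_add φ _ htop fun x hx => ?_
    rcases hgen x hx with ⟨j, rfl⟩ | ⟨j, rfl⟩
    · by_cases h₀ : j = ⟨i, Nat.lt_of_succ_lt h⟩
      · refine ⟨Y ⟨i + 1, h⟩, -(((q : ℂ) - 1) • Y ⟨i + 1, h⟩), ?_⟩
        rw [map_neg, map_smul, hY, hY, h₀, ← sub_eq_add_neg]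
        exact heckeY_mul_T_left q h
      · by_cases h₁ : j = ⟨i + 1, h⟩
        · refine ⟨Y ⟨i, Nat.lt_of_succ_lt h⟩, ((q : ℂ) - 1) • Y ⟨i + 1, h⟩, ?_⟩
          rw [map_smul, hY, hY, hY, h₁]
          exact heckeY_mul_T_right q h
        · refine ⟨Y j, 0, ?_⟩
          rw [map_zero, add_zero, hY]
          exact (heckeT_Y_comm q h j (hval h j h₀ h₁).1 (hval h j h₀ h₁).2).symm
    · by_cases h₀ : j = ⟨i, Nat.lt_of_succ_lt h⟩
      · refine ⟨Y' ⟨i + 1, h⟩, ((q : ℂ) - 1) • Y' ⟨i, Nat.lt_of_succ_lt h⟩, ?_⟩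
        rw [map_smul, hY', hY', hY', h₀]
        exact heckeYInv_mul_T_left q h
      · by_cases h₁ : j = ⟨i + 1, h⟩
        · refine ⟨Y' ⟨i, Nat.lt_of_succ_lt h⟩, -(((q : ℂ) - 1) • Y' ⟨i, Nat.lt_of_succ_lt h⟩), ?_⟩
          rw [map_neg, map_smul, hY', hY', h₁, ← sub_eq_add_neg]
          exact heckeYInv_mul_T_right q h
        · refine ⟨Y' j, 0, ?_⟩
          rw [map_zero, add_zero, hY']
          exact (heckeT_YInv_comm q h j (hval h j h₀ h₁).1 (hval h j h₀ h₁).2).symm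

end CrossRelations

theorem mainTheorem5 {k : ℕ} (n : Fin k → ℕ) (q : Fin k → ℂˣ)
    (J : Ideal (Zc (BlockHecke n q))) (hJ : J.IsMaximal)
    (π₁ π₂ : ModuleCat.{0} (BlockHecke n q))
    (hπ₁ : Module.Finite (BlockHecke n q) π₁) (hπ₂ : Module.Finite (BlockHecke n q) π₂) :
    ∃ (_ : Abelian (CHat J)) (_ : HasExt.{1} (CHat J))
      (h₁ : IsCHat J (completion J π₁)) (h₂ : IsCHat J (completion J π₂)), ∀ i : ℕ,
      (∃ e : ZHat J ⊗[Zc (BlockHecke n q)] Ext π₁ π₂ i ≃+ Ext π₁ (completion J π₂) i,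
        ∀ (r : ZHat J) x,
          e (r • x) = (e x).comp (Ext.mk₀ (completionScalar J π₂ r)) (add_zero i)) ∧
      (∃ e : ZHat J ⊗[Zc (BlockHecke n q)] Ext π₁ π₂ i ≃+
          Ext (completionObj J π₁ h₁) (completionObj J π₂ h₂) i,
        ∀ (r : ZHat J) x,
          e (r • x) = (e x).comp (Ext.mk₀ (completionObjScalar J π₂ h₂ r)) (add_zero i)) ∧
      (((IsFiniteLength (BlockHecke n q) π₁ ∧ IsCHat J π₁) ∨
          (IsFiniteLength (BlockHecke n q) π₂ ∧ IsCHat J π₂)) →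
        Module.Finite ℂ (Ext π₁ π₂ i) →
        ∃ e : Ext π₁ π₂ i ≃+ Ext (completionObj J π₁ h₁) (completionObj J π₂ h₂) i,
          ∀ (z : Zc (BlockHecke n q)) x,
            e (z • x) = (e x).comp
              (Ext.mk₀ (completionObjScalar J π₂ h₂ (algebraMap _ (ZHat J) z)))
              (add_zero i)) := by
  have hcentral : IsFiniteOverCentral ℂ (BlockHecke n q) :=
    IsFiniteOverCentral.piTensorProduct fun i => isFiniteOverCentral_affineHecke (n i) (q i)
  have := hcentral.module_finite
  have := hcentral.isNoetherianRing
  have h₁ : IsCHat J (completion J π₁) := isCHat_completion J π₁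
  have h₂ : IsCHat J (completion J π₂) := isCHat_completion J π₂
  -- The abelian structure comes from the closure properties of `IsCHat J` inside modules. The
  -- standard `Ext` groups live in universe 1, as do the objects of `CHat J`.
  refine ⟨inferInstance, HasExt.standard _, h₁, h₂, fun i => ?_⟩
  let _ : HasExt.{1} (CHat J) := HasExt.standard _
  exact ⟨exists_ext_completion_equiv J π₁ π₂ i, exists_ext_chat_equiv J π₁ π₂ h₁ h₂ i,
    fun h _ => exists_ext_chat_equiv_of_isFiniteLength J π₁ π₂ h₁ h₂ i h⟩
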